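/- **Setting.** Fix $d\ge 1$ and consider $\mathbb{Z}^d$ with the Cayley graph of its standard generators, graph distance $d(\cdot,\cdot)$ and balls $\mathcal{B}(v,r)$. *LCLs.* A locally checkable problem (LCL) $\Pi=(\Sigma_{in},\Sigma_{out},t,\mathcal{P})$ consists of finite sets $\Sigma_{in},\Sigma_{out}$, a number $t\in\mathbb{N}$ and a set $\mathcal{P}$ of $(\Sigma_{in}\times\Sigma_{out})$-labelings of the rooted ball of radius $t$. For an input labeling $\sigma:\mathbb{Z}^d\to\Sigma_{in}$, a map $c:\mathbb{Z}^d\to\Sigma_{out}$ is a $\Pi$-coloring if the labeled ball $\mathcal{B}(v,t)$ (rooted at $v$) lies in $\mathcal{P}$ for every $v$. *Uniform local algorithms.* A uniform local algorithm $\mathcal{A}$ is a measurable partial function on rooted balls $\mathcal{B}(v,r)$, $r\in\mathbb{N}$, labeled by input labels and by elements of $[0,1]$ (taken up to translation); each vertex $v$ of $\mathbb{Z}^d$ gets the value at the smallest ball around $v$ on which $\mathcal{A}$ is defined, and the radius of this ball is the coding radius at $v$; $R_\mathcal{A}$ is the coding radius at the origin. The labels in $[0,1]$ are iid uniform. Probabilities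 of events about $R_{\mathcal{A}}$, and its moments, are understood as suprema over all input labelings. $\mathcal{A}$ solves $\Pi$ if for every input labeling the outputs form, with probability $1$, a $\Pi$-coloring. $\mathcal{A}$ has uniform complexity $t(\varepsilon)$ if $\mathbb{P}(R_{\mathcal{A}}>t(\varepsilon))<\varepsilon$ for all $\varepsilon\in(0,1)$; $\Pi\in\mathsf{ULOCAL}(t(\varepsilon))$ if some uniform local algorithm of uniform complexity $t(\varepsilon)$ solves $\Pi$. The asymptotic notation refers to $\varepsilon\to 0$. ${\bf M}(\Pi)\in[0,\infty]$ is the supremum of all $\alpha\ge 0$ such that some uniform local algorithm $\mathcal{A}$ solves $\Pi$ and $\mathbb{E}(R_\mathcal{A}^\alpha)<\infty$. *Toasts.* For a finite $D\subseteq\mathbb{Z}^d$ let $\partial D$ be the set of vertices of $D$ with a neighbor outside $D$. For $q\in\mathbb{N}$, a $q$-toast is a collection $\mathcal{D}$ of finite nonempty connected subsets of $\mathbb{Z}^d$ (pieces) such that any two vertices lie in a common piece, any two pieces $D,E$ with $d(\partial D,\partial E)\le q$ are equal, and $\mathcal{D}$ is laminar (any two pieces are nested or disjoint). A uniform local algorithm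 produces a $q$-toast if with probability $1$ there is a $q$-toast $\mathcal{D}$ such that every vertex outputs whether or not it lies on $\partial D$ for some $D\in\mathcal{D}$; $\widetilde R$ denotes the coding radius that a vertex $v$ needs in order to describe the minimal piece $D\in\mathcal{D}$ with $v\in D$. *The class $\mathsf{TOAST}$.* A spontaneous toast algorithm takes a finite nonempty connected $\Sigma_{in}$-labeled set $A\subseteq\mathbb{Z}^d$ and a partial map $c$ from $A$ to $\Sigma_{out}$ and returns a map $A\to\Sigma_{out}$ extending $c$ that depends only on $(A,c)$ up to translation. It is applied along a toast $\mathcal{D}$ from smaller to larger pieces: at a piece $D$ it is given the set $D$ and the union of the colorings of all pieces $E\subsetneq D$; the union over all $D\in\mathcal{D}$ is a coloring of $\mathbb{Z}^d$. $\Pi\in\mathsf{TOAST}$ if there are $q\in\mathbb{N}$ and a spontaneous toast algorithm that produces a $\Pi$-coloring for every input labeling and every $q$-toast. **Theorem.** 1. For every $q\in\mathbb{N}$ there is a uniform local algorithm (without input) that produces a $q$-toast, such that its uniform complexity, and also the complexity of describing the minimal piece at a vertex, is at most $\frac1\varepsilon 2^{O(\sqrt{\log 1/\varepsilon})}$, i.e.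 $\mathbb{P}\bigl(\widetilde R>\frac1\varepsilon 2^{O(\sqrt{\log 1/\varepsilon})}\bigr)<\varepsilon$. 2. If an LCL $\Pi$ is in $\mathsf{TOAST}$, then $$\Pi\in\mathsf{ULOCAL}\Bigl(\tfrac1\varepsilon\cdot 2^{O(\sqrt{\log 1/\varepsilon})}\Bigr)\subseteq\mathsf{ULOCAL}\bigl((1/\varepsilon)^{1+o(1)}\bigr),\qquad\text{and } {\bf M}(\Pi)\ge 1,$$ where the inclusion holds between the whole classes of LCLs. -/

import Mathlib

open MeasureTheory Filter Topology Asymptotics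
open scoped NNReal ENNReal

namespace GridLocal

/-! ### The grid -/

/-- The vertex set of the infinite `d`-dimensional grid. -/
abbrev Grid (d : ℕ) : Type := Fin d → ℤ

/-- The graph distance of the grid (Cayley graph of `ℤ^d` for the standard generators), that is,
the `ℓ¹`-distance. -/
def gridDist {d : ℕ} (v w : Grid d) : ℕ := ∑ i, (v i - w i).natAbs

/-- The Cayley graph of `ℤ^d` for the standard generators: two vertices are adjacent when they
differ by `± 1` in exactly one coordinate. Edges are moreover oriented and labelled by the
generators, so that the isomorphisms between (labelled) pieces of the grid that are taken into
account below are the translations. -/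
def gridGraph (d : ℕ) : SimpleGraph (Grid d) where
  Adj v w := gridDist v w = 1
  symm := by
    constructor
    intro v w h
    have h2 : gridDist w v = gridDist v w := by
      unfold gridDist
      exact Finset.sum_congr rfl fun i _ => by rw [← Int.natAbs_neg, neg_sub]
    rw [h2]
    exact h
  loopless := ⟨fun v h => by simp [gridDist] at h⟩

/-- The ball of radius `r` around the origin; it stands for the rooted grid of radius `r`. -/
abbrev Ball (d r : ℕ) : Type := {u : Grid d // gridDist u 0 ≤ r}

/-- The labelling of the rooted ball of radius `r` that is seen from the vertex `v`. -/
def view {d : ℕ} {S : Type*} (y : Grid d → S) (v : Grid d) (r : ℕ) : Ball d r → S :=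
  fun u => y (v + u)

/-- The translate `D + g` of a finite set of vertices. -/
def shiftSet {d : ℕ} (g : Grid d) (D : Finset (Grid d)) : Finset (Grid d) :=
  D.map (addRightEmbedding g)

/-! ### Locally checkable problems -/

/-- A locally checkable problem on `ℤ^d` with input labels `Sin` and output labels `Sout` (both
are assumed to be finite wherever the definition is used): a locality `t` and a set of allowed
labellings of the rooted grid of radius `t`. -/
structure LCL (d : ℕ) (Sin Sout : Type*) where
  t : ℕ
  allowed : Set (Ball d t → Sin × Sout)

/-- The output labelling `c` is a solution for the input labelling `σ`. -/
def LCL.IsColoring {d : ℕ} {Sin Sout : Type*} (L : LCL d Sin Sout)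
    (σ : Grid d → Sin) (c : Grid d → Sout) : Prop :=
  ∀ v, view (fun u => (σ u, c u)) v L.t ∈ L.allowed

/-! ### Uniform local algorithms -/

/-- The law of an iid labelling of the grid by uniform elements of `[0,1]`. -/
noncomputable def iidMeasure (d : ℕ) : Measure (Grid d → unitInterval) :=
  Measure.infinitePi fun _ : Grid d => (volume : Measure unitInterval)

/-- A uniform local algorithm: a measurable partial function on rooted balls that are labelled by
input labels and by elements of `[0,1]`. The balls of radius `r` at which the algorithm is ready
to answer are those with `rule r σ x ≠ none`. (The output set is countable in all uses, so that
measurability of the fibres is measurability.) -/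
structure UniformAlgorithm (d : ℕ) (Sin Sout : Type*) where
  rule : (r : ℕ) → (Ball d r → Sin) → (Ball d r → unitInterval) → Option Sout
  measurable_rule : ∀ (r : ℕ) (σ : Ball d r → Sin) (o : Sout),
    MeasurableSet {x : Ball d r → unitInterval | rule r σ x = some o}

namespace UniformAlgorithm

variable {d : ℕ} {Sin Sout : Type*} (A : UniformAlgorithm d Sin Sout)

/-- The algorithm, run at `v`, is ready to answer when it sees the ball of radius `r`. -/
def Halts (σ : Grid d → Sin) (x : Grid d → unitInterval) (v : Grid d) (r : ℕ) : Prop :=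
  A.rule r (view σ v r) (view x v r) ≠ none

/-- The coding radius at the vertex `v`: the least radius at which the algorithm is ready to
answer (`⊤` if there is none). -/
noncomputable def radius (σ : Grid d → Sin) (x : Grid d → unitInterval) (v : Grid d) : ℕ∞ :=
  ⨅ (r : ℕ) (_ : A.Halts σ x v r), (r : ℕ∞)

open Classical in
/-- The output at `v`: the answer at the least radius at which there is one. -/
noncomputable def output (σ : Grid d → Sin) (x : Grid d → unitInterval) (v : Grid d) : Option Sout :=
  if h : ∃ r, A.Halts σ x v r then
    A.rule (Nat.find h) (view σ v (Nat.find h)) (view x v (Nat.find h))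
  else none

/-- The uniform complexity of the algorithm is (at most) `t`: the probability that the coding
radius exceeds `t ε`, taken at the worst input labelling, is less than `ε`. -/
def HasComplexity (t : ℝ → ℝ) : Prop :=
  ∀ ε ∈ Set.Ioo (0 : ℝ) 1,
    ⨆ σ : Grid d → Sin,
      iidMeasure d {x | ((t ε : ℝ) : EReal) < ((A.radius σ x 0 : ℝ≥0∞) : EReal)}
        < ENNReal.ofReal ε

/-- The coding radius has a finite `α`-moment (uniformly in the input labelling). -/
def HasFiniteMoment (α : ℝ≥0) : Prop :=
  ⨆ σ : Grid d → Sin, ∫⁻ x, (A.radius σ x 0 : ℝ≥0∞) ^ (α : ℝ) ∂(iidMeasure d) < ∞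

/-- The algorithm solves `L`: for every input labelling, with probability `1` every vertex gets an
output and the outputs form a solution. -/
def Solves (L : LCL d Sin Sout) : Prop :=
  ∀ σ : Grid d → Sin, ∀ᵐ x ∂(iidMeasure d),
    ∃ c : Grid d → Sout, (∀ v, A.output σ x v = some (c v)) ∧ L.IsColoring σ c

end UniformAlgorithm

/-- `L ∈ ULOCAL(t)` for some function `t` in the class `T`. -/
def LCL.InULocal {d : ℕ} {Sin Sout : Type*} (L : LCL d Sin Sout) (T : Set (ℝ → ℝ)) : Prop :=
  ∃ t ∈ T, ∃ A : UniformAlgorithm d Sin Sout, A.Solves L ∧ A.HasComplexity t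

/-- `M(L)`: the supremum of all `α ≥ 0` such that some uniform local algorithm solves `L` and has
a coding radius with finite `α`-moment. -/
noncomputable def LCL.momentExponent {d : ℕ} {Sin Sout : Type*} (L : LCL d Sin Sout) : ℝ≥0∞ :=
  ⨆ (α : ℝ≥0) (_ : ∃ A : UniformAlgorithm d Sin Sout, A.Solves L ∧ A.HasFiniteMoment α),
    (α : ℝ≥0∞)

/-- The functions of the form `(1/ε) 2^{O(√(log 1/ε))}`, as `ε → 0`. -/
def toastRate : Set (ℝ → ℝ) :=
  {t | ∃ g : ℝ → ℝ, g =O[𝓝[>] 0] (fun ε : ℝ => √(Real.logb 2 (1 / ε))) ∧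
    ∀ ε ∈ Set.Ioo (0 : ℝ) 1, t ε = 1 / ε * (2 : ℝ) ^ g ε}

/-- The functions of the form `(1/ε)^{1 + o(1)}`, as `ε → 0`. -/
def nearLinearRate : Set (ℝ → ℝ) :=
  {t | ∃ h : ℝ → ℝ, Tendsto h (𝓝[>] 0) (𝓝 0) ∧
    ∀ ε ∈ Set.Ioo (0 : ℝ) 1, t ε = (1 / ε) ^ (1 + h ε)}

/-! ### Toasts -/

/-- Finite connected (in particular nonempty) sets of vertices. -/
def IsPiece {d : ℕ} (D : Finset (Grid d)) : Prop :=
  ((gridGraph d).induce (D : Set (Grid d))).Connected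

/-- The boundary of `D`: the vertices of `D` with a neighbour outside `D`. -/
def boundary {d : ℕ} (D : Finset (Grid d)) : Set (Grid d) :=
  {v | v ∈ D ∧ ∃ w, w ∉ D ∧ (gridGraph d).Adj v w}

/-- A `q`-toast: a laminar collection of finite connected sets such that any two vertices lie in a
common piece and the boundaries of distinct pieces have distance more than `q`. -/
structure IsToast {d : ℕ} (q : ℕ) (𝒟 : Set (Finset (Grid d))) : Prop where
  isPiece : ∀ D ∈ 𝒟, IsPiece D
  cover : ∀ g h : Grid d, ∃ D ∈ 𝒟, g ∈ D ∧ h ∈ D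
  separated : ∀ D ∈ 𝒟, ∀ E ∈ 𝒟,
    (∃ u ∈ boundary D, ∃ v ∈ boundary E, gridDist u v ≤ q) → D = E
  laminar : ∀ D ∈ 𝒟, ∀ E ∈ 𝒟, D ⊆ E ∨ E ⊆ D ∨ Disjoint D E

/-- The uniform local algorithm `B` produces a `q`-toast `𝒟`, and `P` describes at every vertex
the minimal piece containing it: with probability `1` there is a `q`-toast `𝒟` such that `B` tells
every vertex whether it is on the boundary of a piece of `𝒟`, and `P` tells every vertex `v` the
least piece of `𝒟` that contains `v`, given by its position relative to `v`. The coding radius of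
`P` is thus the radius that a vertex needs to describe the minimal piece containing it. -/
def ProducesToast {d : ℕ} (q : ℕ) (B : UniformAlgorithm d Unit Bool)
    (P : UniformAlgorithm d Unit (Finset (Grid d))) : Prop :=
  ∀ᵐ x ∂(iidMeasure d), ∃ 𝒟 : Set (Finset (Grid d)), IsToast q 𝒟 ∧
    (∀ v, ∃ b, B.output (fun _ => ()) x v = some b ∧ (b = true ↔ ∃ D ∈ 𝒟, v ∈ boundary D)) ∧
    (∀ v, ∃ D, P.output (fun _ => ()) x v = some D ∧
      IsLeast {E | E ∈ 𝒟 ∧ v ∈ E} (shiftSet v D))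

/-! ### Toast algorithms -/

/-- A partial colouring with domain contained in `D`. -/
def SupportedOn {d : ℕ} {Sout : Type*} (c : Grid d → Option Sout) (D : Finset (Grid d)) : Prop :=
  ∀ v, c v ≠ none → v ∈ D

/-- A toast algorithm: for every finite connected set `D` with input labels (those of `σ` in `D`)
and every partial colouring `c` of `D`, it gives a partial colouring of `D` that extends `c` and
depends only on the isomorphism type of the labelled set and the partial colouring, not on the
position in the grid. (For `g = 0`, the last law says that the input labels outside `D` are
irrelevant.) -/
structure ToastAlgorithm (d : ℕ) (Sin Sout : Type*) where
  rule : Finset (Grid d) → (Grid d → Sin) → (Grid d → Option Sout) → Grid d → Option Sout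
  supported : ∀ D σ c, IsPiece D → SupportedOn c D → SupportedOn (rule D σ c) D
  extending : ∀ D σ c, IsPiece D → SupportedOn c D →
    ∀ v o, c v = some o → rule D σ c v = some o
  equivariant : ∀ D σ c, IsPiece D → SupportedOn c D → ∀ (g : Grid d) σ' c',
    (∀ v ∈ D, σ' (v + g) = σ v) → (∀ v, c' (v + g) = c v) →
    ∀ v, rule (shiftSet g D) σ' c' (v + g) = rule D σ c v

namespace ToastAlgorithm

variable {d : ℕ} {Sin Sout : Type*} (A : ToastAlgorithm d Sin Sout)

/-- The algorithm always colours the whole set that it is given. -/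
def IsSpontaneous : Prop :=
  ∀ D σ c, IsPiece D → SupportedOn c D → ∀ v ∈ D, A.rule D σ c v ≠ none

open Classical in
/-- The partial colouring of the piece `D` when the algorithm is applied along the collection `𝒟`,
from smaller to larger pieces: the algorithm is given the union of the partial colourings of all
strictly smaller pieces inside `D`. (In a toast these partial colourings agree where they
overlap, so that the union is a partial map and the choice of a value is immaterial.) -/
noncomputable def colorPiece (𝒟 : Set (Finset (Grid d))) (σ : Grid d → Sin)
    (D : Finset (Grid d)) : Grid d → Option Sout :=
  A.rule D σ fun v =>
    if h : ∃ o, ∃ E, ∃ _ : E ⊂ D, E ∈ 𝒟 ∧ colorPiece 𝒟 σ E v = some o then some h.choose else none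
termination_by D.card
decreasing_by exact Finset.card_lt_card ‹_›

open Classical in
/-- The partial colouring of the grid that the algorithm produces along `𝒟`: the union of the
partial colourings of all pieces. -/
noncomputable def colorGrid (𝒟 : Set (Finset (Grid d))) (σ : Grid d → Sin) :
    Grid d → Option Sout :=
  fun v => if h : ∃ o, ∃ D ∈ 𝒟, A.colorPiece 𝒟 σ D v = some o then some h.choose else none

end ToastAlgorithm

/-- `L ∈ TOAST`: for some `q`, a spontaneous toast algorithm produces a solution for every input
labelling along every `q`-toast. -/
def LCL.InToast {d : ℕ} {Sin Sout : Type*} (L : LCL d Sin Sout) : Prop :=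
  ∃ (q : ℕ) (A : ToastAlgorithm d Sin Sout), A.IsSpontaneous ∧
    ∀ (σ : Grid d → Sin) (𝒟 : Set (Finset (Grid d))), IsToast q 𝒟 →
      ∃ c : Grid d → Sout, (∀ v, A.colorGrid 𝒟 σ v = some (c v)) ∧ L.IsColoring σ c

end GridLocal

open GridLocal

/-! The toast is built on scales `r k = 2 (q + 1) 16 ^ (k ^ 2)`. At one scale, several independent
rounds of sparse random marks are drawn, and every isolated mark is the centre of a cube of radius
`r`. A vertex belongs to the first cube that contains it. Cutting each cube further along the walls
of earlier cubes gives cells that are boxes of diameter O(`r`), which is what makes their deep parts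
connected.

Cells of different scales cross each other. This is cured by `retract`: every scale collapses its
cubes to their centres, and the pieces of scale `k` are connected components of the set of vertices
whose image under all lower collapses lies well inside a cell. Such a set is a union of fibres of
`Scales.retract`, while a piece of a lower scale, together with its `q + 1`-neighbourhood, lies in a
single fibre (`Scales.retract_succ_eq_of_near`). A lower piece is therefore swallowed whole or
avoided, and no boundary of a higher piece comes near it. The lower collapses move vertices by at
most `drift k`, which is small compared with `r k`, so a vertex deep inside its cell is certainly
covered.

The origin fails to lie at depth `s` inside a cell of radius `r` with probability O(`s / r`)
(`measure_badSet_le`): each round hits it with probability bounded below, and a round cuts near it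
with probability O(`s / r`), so a geometric series bounds the chance of being cut before being hit.
With `s` = O(`r (k - 1)`), scale `k ≥ 1` fails with probability O(`16 ^ -(2k - 1)`). The scales are
independent, hence all scales up to `k` fail with probability at most `K ^ k / 16 ^ (k ^ 2)`, while
scale `k` is visible in a ball of radius O(`16 ^ (k ^ 2)`). The product of radius and probability is
`2 ^ O(k)` with `k` of order `√(log 1/ε)`; even passing to the next scale costs only another factor
`2 ^ O(k)`. This yields the rate, and moments of every order below `1`.

Higher pieces that meet a piece contain it, so the least piece at a vertex and all pieces inside it
are already final at the first scale that covers the vertex. A toast algorithm extends earlier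
colours, so the colour of a vertex is fixed by its least piece and can be computed there. -/

namespace GridLocal

variable {d : ℕ}

/-! ### Closeness in the sup-norm -/

/-- `x` and `y` have sup-distance at most `n`. -/
def Near (n : ℕ) (x y : Grid d) : Prop := ∀ a, x a - y a ≤ n ∧ y a - x a ≤ n

theorem Near.refl (n : ℕ) (x : Grid d) : Near n x x := fun a => by simp

theorem Near.symm {n : ℕ} {x y : Grid d} (h : Near n x y) : Near n y x := fun a => (h a).symm

theorem Near.trans {n m k : ℕ} {x y z : Grid d} (h : Near n x y) (h' : Near m y z)
    (hk : n + m ≤ k) : Near k x z := fun a => by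
  have := h a; have := h' a; omega

theorem Near.mono {n m : ℕ} {x y : Grid d} (h : Near n x y) (hk : n ≤ m) : Near m x y := fun a => by
  have := h a; omega

theorem near_add_right {n : ℕ} {x y : Grid d} (g : Grid d) :
    Near n (x + g) (y + g) ↔ Near n x y := by
  simp [Near]

theorem near_of_gridDist_le {n : ℕ} {x y : Grid d} (h : gridDist x y ≤ n) : Near n x y := fun a => by
  have : (x a - y a).natAbs ≤ gridDist x y :=
    Finset.single_le_sum (f := fun i => (x i - y i).natAbs) (fun _ _ => Nat.zero_le _)
      (Finset.mem_univ a)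
  omega

theorem gridDist_le_of_near {n : ℕ} {x y : Grid d} (h : Near n x y) : gridDist x y ≤ d * n := by
  calc gridDist x y ≤ ∑ _i : Fin d, n := Finset.sum_le_sum fun a _ => by have := h a; omega
    _ = d * n := by simp

theorem near_one_of_adj {x y : Grid d} (h : (gridGraph d).Adj x y) : Near 1 x y :=
  near_of_gridDist_le (le_of_eq h)

theorem gridGraph_adj_add_right {x y : Grid d} (g : Grid d) :
    (gridGraph d).Adj (x + g) (y + g) ↔ (gridGraph d).Adj x y := by
  simp [gridGraph, gridDist]

theorem finite_near (n : ℕ) (x : Grid d) : {y | Near n x y}.Finite := by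
  refine (Set.Finite.pi' (fun a => Set.finite_Icc (x a - n) (x a + n))).subset fun y hy a => ?_
  have := hy a
  simp only [Set.mem_Icc]; omega

/-! ### Paths inside boxes -/

/-- The box spanned by two vertices. -/
def InBox (x y z : Grid d) : Prop := ∀ a, (x a ≤ z a ∧ z a ≤ y a) ∨ (y a ≤ z a ∧ z a ≤ x a)

/-- One step of a walk that stays inside `S`. -/
def StepIn (S : Set (Grid d)) (x y : Grid d) : Prop := (gridGraph d).Adj x y ∧ y ∈ S

/-- A unit step towards `y` in a coordinate where `x` and `y` differ lowers the `ℓ¹`-distance by one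
and only shrinks the spanned box, so induction on the distance applies. -/
theorem reflTransGen_stepIn_of_box {S : Set (Grid d)} {x y : Grid d} (h : ∀ z, InBox x y z → z ∈ S) :
    Relation.ReflTransGen (StepIn S) x y := by
  induction hn : gridDist x y generalizing x with
  | zero =>
    have : x = y := by
      funext a
      have := near_of_gridDist_le (le_of_eq hn) a
      simp at this; omega
    rw [this]
  | succ n ih =>
    have hxy : ∃ a, x a ≠ y a := by
      by_contra! hc
      simp [gridDist, hc] at hn
    obtain ⟨a, ha⟩ := hxy
    obtain ⟨s, hs, hsa⟩ : ∃ s : ℤ, (s = 1 ∨ s = -1) ∧ ((x a + s - y a).natAbs + 1 = (x a - y a).natAbs) := by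
      rcases lt_or_gt_of_ne ha with h1 | h1
      · exact ⟨1, by simp, by omega⟩
      · exact ⟨-1, by simp, by omega⟩
    set x' : Grid d := Function.update x a (x a + s) with hx'
    have hx'a : x' a = x a + s := by simp [hx']
    have hx'b : ∀ b, b ≠ a → x' b = x b := fun b hb => by simp [hx', hb]
    have hadj : (gridGraph d).Adj x x' := by
      change gridDist x x' = 1
      unfold gridDist
      rw [Finset.sum_eq_single a]
      · rw [hx'a]; omega
      · intro b _ hb; simp [hx'b b hb]
      · simp
    have hdist : gridDist x' y + 1 = gridDist x y := by
      unfold gridDist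
      rw [← Finset.add_sum_erase _ _ (Finset.mem_univ a),
        ← Finset.add_sum_erase (a := a) (f := fun i => (x i - y i).natAbs) _ (Finset.mem_univ a)]
      rw [Finset.sum_congr rfl (g := fun i => (x i - y i).natAbs)
        (fun b hb => by rw [hx'b b (Finset.ne_of_mem_erase hb)])]
      rw [hx'a]; omega
    have hsub : ∀ z, InBox x' y z → InBox x y z := by
      intro z hz b
      have := hz b
      by_cases hb : b = a
      · subst hb; rw [hx'a] at this; omega
      · rwa [hx'b b hb] at this
    refine Relation.ReflTransGen.head ⟨hadj, h _ (hsub _ ?_)⟩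
      (ih (fun z hz => h z (hsub z hz)) (by omega))
    intro b; omega

/-! ### A single scale: carving by cubes around isolated centres -/

section Layer

/-- `u` is marked, and no other vertex close to it is. -/
def IsCenter (r : ℕ) (χ : Grid d → Bool) (u : Grid d) : Prop :=
  χ u = true ∧ ∀ w, Near (2 * r) u w → χ w = true → w = u

/-- `x` is in the cube around the centre `u` of round `i`, and in no cube of an earlier round. -/
def Captures (r m : ℕ) (χ : ℕ → Grid d → Bool) (i : ℕ) (u x : Grid d) : Prop :=
  i < m ∧ IsCenter r (χ i) u ∧ Near r u x ∧ ∀ j < i, ∀ w, IsCenter r (χ j) w → ¬ Near r w x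

/-- `x` and `y` are on the same side of all the hyperplanes that bound the cube around `w`. -/
def SameSide (r : ℕ) (w x y : Grid d) : Prop :=
  ∀ a, (x a < w a - r ↔ y a < w a - r) ∧ (w a + r < x a ↔ w a + r < y a)

/-- `x` and `y` are captured by the same cube and not separated by a hyperplane bounding a cube of
an earlier round. This is a partial equivalence relation whose classes are boxes. -/
def SameCell (r m : ℕ) (χ : ℕ → Grid d → Bool) (x y : Grid d) : Prop :=
  ∃ i u, Captures r m χ i u x ∧ Captures r m χ i u y ∧
    ∀ j < i, ∀ w, IsCenter r (χ j) w → Near (2 * r) w u → SameSide r w x y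

/-- All vertices near `x` are in the cell of `x`. -/
def Inner (r m : ℕ) (χ : ℕ → Grid d → Bool) (e : ℕ) (x : Grid d) : Prop :=
  ∀ z, Near e x z → SameCell r m χ x z

open Classical in
/-- The map that collapses every captured vertex to the centre of the cube that captures it. -/
noncomputable def collapse (r m : ℕ) (χ : ℕ → Grid d → Bool) (x : Grid d) : Grid d :=
  if h : ∃ u, ∃ i, Captures r m χ i u x then h.choose else x

variable {r m : ℕ} {χ : ℕ → Grid d → Bool} {x y z u w : Grid d} {i j e : ℕ}

/-- A later round cannot capture what an earlier cube contains. Within one round, two centres at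
distance at most `r` from `x` are within `2 * r` of each other, which isolation forbids. -/
theorem Captures.unique (h : Captures r m χ i u x) (h' : Captures r m χ j w x) : i = j ∧ u = w := by
  have hij : i = j := by
    rcases lt_trichotomy i j with hlt | heq | hlt
    · exact absurd h.2.2.1 (h'.2.2.2 i hlt u h.2.1)
    · exact heq
    · exact absurd h'.2.2.1 (h.2.2.2 j hlt w h'.2.1)
  subst hij
  exact ⟨rfl, (h.2.1.2 w (h.2.2.1.trans h'.2.2.1.symm (by omega)) h'.2.1.1).symm⟩

theorem SameCell.symm (h : SameCell r m χ x y) : SameCell r m χ y x := by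
  obtain ⟨i, u, hx, hy, h⟩ := h
  exact ⟨i, u, hy, hx, fun j hj w hw hn a => ⟨(h j hj w hw hn a).1.symm, (h j hj w hw hn a).2.symm⟩⟩

theorem SameCell.trans (h : SameCell r m χ x y) (h' : SameCell r m χ y z) : SameCell r m χ x z := by
  obtain ⟨i, u, hx, hy, h⟩ := h
  obtain ⟨i', u', hy', hz, h'⟩ := h'
  obtain ⟨rfl, rfl⟩ := hy.unique hy'
  exact ⟨i, u, hx, hz, fun j hj w hw hn a =>
    ⟨(h j hj w hw hn a).1.trans (h' j hj w hw hn a).1,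
     (h j hj w hw hn a).2.trans (h' j hj w hw hn a).2⟩⟩

theorem SameCell.near (h : SameCell r m χ x y) : Near (2 * r) x y := by
  obtain ⟨i, u, hx, hy, -⟩ := h
  exact hx.2.2.1.symm.trans hy.2.2.1 (by omega)

/-- Cells are boxes. An earlier cube containing `z` has its centre within `2 * r` of `u`, so its
walls are among those that do not separate `x` from `y`, hence not `x` from `z`; it would then
contain `x` too. -/
theorem SameCell.of_inBox (h : SameCell r m χ x y) (hz : InBox x y z) : SameCell r m χ x z := by
  obtain ⟨i, u, hx, hy, h⟩ := h
  have hzu : Near r u z := fun a => by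
    have := hx.2.2.1 a; have := hy.2.2.1 a; have := hz a; omega
  have hs : ∀ j < i, ∀ w, IsCenter r (χ j) w → Near (2 * r) w u → SameSide r w x z := by
    intro j hj w hw hn a
    have := h j hj w hw hn a; have := hz a; omega
  refine ⟨i, u, hx, ⟨hx.1, hx.2.1, hzu, fun j hj w hw hn => ?_⟩, hs⟩
  refine hx.2.2.2 j hj w hw fun a => ?_
  have := hs j hj w hw (hn.trans hzu.symm (by omega)) a
  have := hn a
  omega

theorem collapse_eq (h : Captures r m χ i u x) : collapse r m χ x = u := by
  have hex : ∃ u, ∃ i, Captures r m χ i u x := ⟨u, i, h⟩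
  rw [collapse, dif_pos hex]
  obtain ⟨j, hj⟩ := hex.choose_spec
  exact (hj.unique h).2

theorem SameCell.collapse_eq (h : SameCell r m χ x y) : collapse r m χ x = collapse r m χ y := by
  obtain ⟨i, u, hx, hy, -⟩ := h
  rw [GridLocal.collapse_eq hx, GridLocal.collapse_eq hy]

theorem collapse_of_not (h : ¬ ∃ u, ∃ i, Captures r m χ i u x) : collapse r m χ x = x := by
  rw [collapse, dif_neg h]

theorem near_collapse (x : Grid d) : Near r x (collapse r m χ x) := by
  by_cases h : ∃ u, ∃ i, Captures r m χ i u x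
  · obtain ⟨u, i, h⟩ := h
    rw [collapse_eq h]; exact h.2.2.1.symm
  · rw [collapse_of_not h]; exact Near.refl _ _

theorem Inner.mono {e' : ℕ} (h : Inner r m χ e x) (he : e' ≤ e) : Inner r m χ e' x :=
  fun z hz => h z (hz.mono he)

theorem Inner.of_near {e' n : ℕ} (h : Inner r m χ e x) (hy : Near n x y) (he : n + e' ≤ e) :
    Inner r m χ e' y := fun z hz =>
  (h y (hy.mono (by omega))).symm.trans (h z (hy.trans hz he))

/-- The inner part of a box is a box: a perturbation `z'` of `z` lies in the box spanned by the
equally perturbed `x` and `y`, which are both still in the cell. -/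
theorem Inner.of_inBox (hx : Inner r m χ e x) (hy : Inner r m χ e y) (h : SameCell r m χ x y)
    (hz : InBox x y z) : Inner r m χ e z := by
  intro z' hz'
  have h1 : SameCell r m χ x (x + (z' - z)) := hx _ fun a => by
    have := hz' a; simp; omega
  have h2 : SameCell r m χ y (y + (z' - z)) := hy _ fun a => by
    have := hz' a; simp; omega
  have h3 : SameCell r m χ (x + (z' - z)) z' := ((h1.symm.trans h).trans h2).of_inBox fun a => by
    have := hz a; simp; omega
  exact (h.of_inBox hz).symm.trans (h1.trans h3)

/-- Some coordinate of `x` is within distance `e` of a hyperplane bounding the cube around `w`. -/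
def Cuts (r e : ℕ) (w x : Grid d) : Prop :=
  ∃ a, ((r : ℤ) - e < w a - x a ∧ w a - x a ≤ r + e) ∨ ((r : ℤ) - e < x a - w a ∧ x a - w a ≤ r + e)

/-- With no wall of an earlier cube within `e` of `x` in any coordinate, the whole `e`-neighbourhood
of `x` has the same position as `x` relative to these walls. Checking centres within `3 * r` of `x`
suffices, since the relevant ones are within `2 * r` of `u`. -/
theorem inner_of_captures_of_not_cuts (he : e ≤ r) (hi : i < m) (hu : IsCenter r (χ i) u)
    (hux : Near (r - e) u x) (hcap : ∀ j < i, ∀ w, IsCenter r (χ j) w → ¬ Near (r - e) w x)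
    (hcut : ∀ j < i, ∀ w, IsCenter r (χ j) w → Near (3 * r) w x → ¬ Cuts r e w x) :
    Inner r m χ e x := by
  have key : ∀ z, Near e x z → Captures r m χ i u z := by
    intro z hz
    refine ⟨hi, hu, hux.trans hz (by omega), fun j hj w hw hwz => ?_⟩
    refine hcap j hj w hw fun a => ?_
    by_contra hc
    refine hcut j hj w hw (hwz.trans hz.symm (by omega)) ⟨a, ?_⟩
    have := hwz a; have := hz a
    omega
  intro z hz
  refine ⟨i, u, key x (Near.refl _ _), key z hz, fun j hj w hw hwu a => ?_⟩
  have hc := hcut j hj w hw (hwu.trans hux (by omega))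
  have hc' : ¬ (((r : ℤ) - e < w a - x a ∧ w a - x a ≤ r + e) ∨
      ((r : ℤ) - e < x a - w a ∧ x a - w a ≤ r + e)) := fun h => hc ⟨a, h⟩
  have := hz a
  omega

/-! #### Locality and equivariance -/

theorem isCenter_congr {χ χ' : Grid d → Bool} (h : ∀ w, Near (2 * r) u w → χ w = χ' w) :
    IsCenter r χ u ↔ IsCenter r χ' u := by
  unfold IsCenter
  rw [h u (Near.refl _ _)]
  refine and_congr_right fun _ => forall_congr' fun w => forall_congr' fun hw => ?_
  rw [h w hw]

/-- The radius is `r` to reach a possible centre plus `2 * r` to test its isolation. For cells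
another `2 * r` is added, the bound on their diameter, whence the `5 * r` below. -/
theorem captures_congr {χ χ' : ℕ → Grid d → Bool}
    (h : ∀ j < m, ∀ w, Near (3 * r) x w → χ j w = χ' j w) :
    Captures r m χ i u x ↔ Captures r m χ' i u x := by
  have hc : ∀ j < m, ∀ w, Near r w x → (IsCenter r (χ j) w ↔ IsCenter r (χ' j) w) :=
    fun j hj w hw => isCenter_congr fun w' hw' => h j hj w' (hw.symm.trans hw' (by omega))
  unfold Captures
  constructor
  · rintro ⟨h1, h2, h3, h4⟩
    exact ⟨h1, (hc i h1 u h3).1 h2, h3, fun j hj w hw hn =>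
      h4 j hj w ((hc j (hj.trans h1) w hn).2 hw) hn⟩
  · rintro ⟨h1, h2, h3, h4⟩
    exact ⟨h1, (hc i h1 u h3).2 h2, h3, fun j hj w hw hn =>
      h4 j hj w ((hc j (hj.trans h1) w hn).1 hw) hn⟩

theorem collapse_congr {χ χ' : ℕ → Grid d → Bool}
    (h : ∀ j < m, ∀ w, Near (3 * r) x w → χ j w = χ' j w) :
    collapse r m χ x = collapse r m χ' x := by
  by_cases hc : ∃ u, ∃ i, Captures r m χ i u x
  · obtain ⟨u, i, hc⟩ := hc
    rw [collapse_eq hc, collapse_eq ((captures_congr h).1 hc)]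
  · rw [collapse_of_not hc, collapse_of_not]
    rintro ⟨u, i, hc'⟩
    exact hc ⟨u, i, (captures_congr h).2 hc'⟩

theorem SameCell.congr {χ χ' : ℕ → Grid d → Bool}
    (h : ∀ j < m, ∀ w, Near (5 * r) x w → χ j w = χ' j w) (hxy : SameCell r m χ x y) :
    SameCell r m χ' x y := by
  have hn := hxy.near
  obtain ⟨i, u, hx, hy, hs⟩ := hxy
  refine ⟨i, u, (captures_congr fun j hj w hw => h j hj w (hw.mono (by omega))).1 hx,
    (captures_congr fun j hj w hw => h j hj w (hn.trans hw (by omega))).1 hy,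
    fun j hj w hw hwu => hs j hj w ?_ hwu⟩
  refine (isCenter_congr fun w' hw' => ?_).2 hw
  exact h j (hj.trans hx.1) w' ((hx.2.2.1.symm.trans hwu.symm le_rfl).trans hw' (by omega))

theorem inner_congr {χ χ' : ℕ → Grid d → Bool}
    (h : ∀ j < m, ∀ w, Near (5 * r) x w → χ j w = χ' j w) :
    Inner r m χ e x ↔ Inner r m χ' e x :=
  ⟨fun hx z hz => (hx z hz).congr h,
   fun hx z hz => (hx z hz).congr fun j hj w hw => (h j hj w hw).symm⟩

theorem isCenter_shift (g : Grid d) {χ : Grid d → Bool} :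
    IsCenter r (fun v => χ (v + g)) u ↔ IsCenter r χ (u + g) := by
  unfold IsCenter
  refine and_congr_right fun _ => ⟨fun h w hw hχ => ?_, fun h w hw hχ => ?_⟩
  · have := h (w - g) (by rw [← near_add_right g]; simpa using hw) (by simpa using hχ)
    rw [← this]; simp
  · exact add_right_cancel (h (w + g) ((near_add_right g).2 hw) hχ)

theorem captures_shift (g : Grid d) :
    Captures r m (fun j v => χ j (v + g)) i u x ↔ Captures r m χ i (u + g) (x + g) := by
  unfold Captures
  simp only [isCenter_shift, near_add_right]
  refine and_congr_right fun _ => and_congr_right fun _ => and_congr_right fun _ =>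
    forall_congr' fun j => forall_congr' fun _ => ⟨fun h w hw hn => ?_, fun h w hw hn => ?_⟩
  · exact h (w - g) (by simpa using hw) (by rw [← near_add_right g]; simpa using hn)
  · exact h (w + g) hw ((near_add_right g).2 hn)

theorem collapse_shift (g : Grid d) :
    collapse r m (fun j v => χ j (v + g)) x + g = collapse r m χ (x + g) := by
  by_cases hc : ∃ u, ∃ i, Captures r m (fun j v => χ j (v + g)) i u x
  · obtain ⟨u, i, hc⟩ := hc
    rw [collapse_eq hc, collapse_eq ((captures_shift g).1 hc)]
  · rw [collapse_of_not hc, collapse_of_not]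
    rintro ⟨u, i, hc'⟩
    exact hc ⟨u - g, i, (captures_shift g).2 (by simpa using hc')⟩

theorem sameSide_shift (g : Grid d) :
    SameSide r (w + g) (x + g) (y + g) ↔ SameSide r w x y := by
  unfold SameSide
  refine forall_congr' fun a => ?_
  simp only [Pi.add_apply]
  constructor <;> intro h <;> omega

theorem sameCell_shift (g : Grid d) :
    SameCell r m (fun j v => χ j (v + g)) x y ↔ SameCell r m χ (x + g) (y + g) := by
  unfold SameCell
  constructor
  · rintro ⟨i, u, hx, hy, h⟩
    refine ⟨i, u + g, (captures_shift g).1 hx, (captures_shift g).1 hy, fun j hj w hw hn => ?_⟩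
    have := h j hj (w - g) ((isCenter_shift g).2 (by simpa using hw))
      (by rw [← near_add_right g]; simpa using hn)
    rw [← sameSide_shift g] at this
    simpa using this
  · rintro ⟨i, u, hx, hy, h⟩
    refine ⟨i, u - g, (captures_shift g).2 (by simpa using hx),
      (captures_shift g).2 (by simpa using hy), fun j hj w hw hn => ?_⟩
    have := h j hj (w + g) ((isCenter_shift g).1 hw)
      (by rw [← near_add_right g] at hn; simpa using hn)
    rwa [sameSide_shift g] at this

theorem inner_shift (g : Grid d) :
    Inner r m (fun j v => χ j (v + g)) e x ↔ Inner r m χ e (x + g) := by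
  unfold Inner
  constructor
  · intro h z hz
    have := (sameCell_shift g).1 (h (z - g) (by rw [← near_add_right g]; simpa using hz))
    simpa using this
  · intro h z hz
    exact (sameCell_shift g).2 (h (z + g) ((near_add_right g).2 hz))

end Layer

/-! ### The toast built from a sequence of scales -/

/-- Marks on the vertices, for every level and every round of this level. -/
abbrev Marks (d : ℕ) : Type := ℕ → ℕ → Grid d → Bool

/-- The radii of the cubes and the numbers of rounds at all levels, and the separation of the
pieces that is asked for. -/
structure Scales where
  r : ℕ → ℕ
  m : ℕ → ℕ
  q : ℕ

namespace Scales

variable (P : Scales)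

/-- A bound on the distance by which the collapses of the levels below `k` move a vertex. -/
def drift (k : ℕ) : ℕ := ∑ i ∈ Finset.range k, P.r i

/-- The distance that the pieces of level `k` keep from the boundaries of the cells. -/
def margin (k : ℕ) : ℕ := P.q + 1 + 2 * P.drift k

/-- The depth inside its cell at which a vertex is certain to be covered at level `k`. -/
def depth (k : ℕ) : ℕ := P.margin k + P.drift k

/-- The composition of the collapses of all levels below `k`. -/
noncomputable def retract (χ : Marks d) : ℕ → Grid d → Grid d
  | 0, v => v
  | k + 1, v => collapse (P.r k) (P.m k) (χ k) (retract χ k v)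

/-- The vertices whose image after all lower collapses is well inside the cell of `z`. -/
def region (χ : Marks d) (k : ℕ) (z : Grid d) : Set (Grid d) :=
  {v | Inner (P.r k) (P.m k) (χ k) (P.margin k) (P.retract χ k v) ∧
    SameCell (P.r k) (P.m k) (χ k) z (P.retract χ k v)}

/-- The vertices that are connected to `z` inside its region. -/
def component (χ : Marks d) (k : ℕ) (z : Grid d) : Set (Grid d) :=
  {v | Relation.ReflTransGen (StepIn (P.region χ k z)) z v}

/-- `z` is deep inside a cell of level `k`. -/
def Deep (χ : Marks d) (k : ℕ) (z : Grid d) : Prop :=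
  Inner (P.r k) (P.m k) (χ k) (P.depth k) z

/-- The pieces of level `k`. -/
def level (χ : Marks d) (k : ℕ) : Set (Finset (Grid d)) :=
  {D | ∃ z, P.Deep χ k z ∧ (D : Set (Grid d)) = P.component χ k z}

/-- The pieces of the levels up to `k`. -/
def levelsUpTo (χ : Marks d) (k : ℕ) : Set (Finset (Grid d)) := {D | ∃ l ≤ k, D ∈ P.level χ l}

/-- The pieces of all levels. -/
def toast (χ : Marks d) : Set (Finset (Grid d)) := {D | ∃ k, D ∈ P.level χ k}

/-! ### Deterministic part: the pieces of all levels form a toast -/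

variable {P} {χ : Marks d} {k l : ℕ} {x y z v w : Grid d} {D E : Finset (Grid d)}

theorem drift_succ (k : ℕ) : P.drift (k + 1) = P.drift k + P.r k := Finset.sum_range_succ _ _

theorem near_retract (χ : Marks d) (k : ℕ) (v : Grid d) :
    Near (P.drift k) v (P.retract χ k v) := by
  induction k with
  | zero => exact Near.refl _ _
  | succ k ih => exact ih.trans (near_collapse _) (by rw [drift_succ])

theorem retract_eq_of_le (hkl : k ≤ l) (h : P.retract χ k v = P.retract χ k w) :
    P.retract χ l v = P.retract χ l w := by
  induction l, hkl using Nat.le_induction with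
  | base => exact h
  | succ l _ ih => simp [retract, ih]

/-- Vertices close to a region of level `k` are identified by the collapses up to level `k`. -/
theorem sameCell_retract_of_near (hv : v ∈ P.region χ k z) (h : Near (P.q + 1) v w) :
    SameCell (P.r k) (P.m k) (χ k) (P.retract χ k v) (P.retract χ k w) :=
  hv.1 _ (((near_retract χ k v).symm.trans h le_rfl).trans (near_retract χ k w)
    (by unfold margin; omega))

/-- The images of `v` and `w` differ by at most `q + 1 + 2 * drift k`, which is exactly `margin k`.
They share a cell, so the next collapse merges them. -/
theorem retract_succ_eq_of_near (hv : v ∈ P.region χ k z) (h : Near (P.q + 1) v w) :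
    P.retract χ (k + 1) v = P.retract χ (k + 1) w :=
  (sameCell_retract_of_near hv h).collapse_eq

theorem retract_succ_eq_of_mem (hv : v ∈ P.region χ k z) (hw : w ∈ P.region χ k z) :
    P.retract χ (k + 1) v = P.retract χ (k + 1) w :=
  (hv.2.symm.trans hw.2).collapse_eq

/-- Regions are unions of fibres of `retract`, because membership is tested on the image only. This
is what prevents higher pieces from splitting lower ones. -/
theorem mem_region_of_retract_eq (h : P.retract χ k v = P.retract χ k w)
    (hv : v ∈ P.region χ k z) : w ∈ P.region χ k z := by
  unfold region at *
  rw [Set.mem_ofPred_eq] at *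
  rwa [← h]

theorem region_eq_of_sameCell (h : SameCell (P.r k) (P.m k) (χ k) x y) :
    P.region χ k x = P.region χ k y := by
  ext v
  exact ⟨fun hv => ⟨hv.1, h.symm.trans hv.2⟩, fun hv => ⟨hv.1, h.trans hv.2⟩⟩

theorem Deep.mem_region (hz : P.Deep χ k z) : z ∈ P.region χ k z :=
  ⟨hz.of_near (near_retract χ k z) (by unfold depth; omega),
    hz _ ((near_retract χ k z).mono (by unfold depth; omega))⟩

theorem Deep.component_subset (hz : P.Deep χ k z) : P.component χ k z ⊆ P.region χ k z := by
  intro v hv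
  rcases Relation.ReflTransGen.cases_tail hv with h | ⟨w, -, hw⟩
  · rw [h]; exact hz.mem_region
  · exact hw.2

theorem self_mem_component : z ∈ P.component χ k z := Relation.ReflTransGen.refl

theorem stepIn_symm {S : Set (Grid d)} (hx : x ∈ S) (h : StepIn S x y) : StepIn S y x :=
  ⟨h.1.symm, hx⟩

theorem reflTransGen_stepIn_mem {S : Set (Grid d)} (hx : x ∈ S)
    (h : Relation.ReflTransGen (StepIn S) x y) : y ∈ S := by
  rcases Relation.ReflTransGen.cases_tail h with h | ⟨w, -, hw⟩
  · rwa [h]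
  · exact hw.2

theorem reflTransGen_stepIn_symm {S : Set (Grid d)} (hx : x ∈ S)
    (h : Relation.ReflTransGen (StepIn S) x y) : Relation.ReflTransGen (StepIn S) y x := by
  induction h with
  | refl => exact .refl
  | tail h1 h2 ih => exact .head (stepIn_symm (reflTransGen_stepIn_mem hx h1) h2) ih

/-- The deep vertices of a cell form a box and lie in the region, so box paths join them. The region
itself may be disconnected, but only one of its components contains deep vertices and becomes a
piece. -/
theorem Deep.component_eq (hx : P.Deep χ k x) (hy : P.Deep χ k y)
    (h : SameCell (P.r k) (P.m k) (χ k) x y) : P.component χ k x = P.component χ k y := by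
  have hreg := region_eq_of_sameCell h
  have hpath : Relation.ReflTransGen (StepIn (P.region χ k x)) x y := by
    refine reflTransGen_stepIn_of_box fun z hz => ?_
    have hxz := h.of_inBox hz
    rw [region_eq_of_sameCell hxz]
    exact Deep.mem_region (Inner.of_inBox hx hy h hz)
  have hback := reflTransGen_stepIn_symm hx.mem_region hpath
  ext v
  unfold component
  rw [Set.mem_ofPred_eq, Set.mem_ofPred_eq, ← hreg]
  exact ⟨fun hv => hback.trans hv, fun hv => hpath.trans hv⟩

theorem region_near (hv : v ∈ P.region χ k z) : Near (2 * P.r k + P.drift k) z v :=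
  hv.2.near.trans (near_retract χ k v).symm le_rfl

theorem Deep.exists_mem_level (hz : P.Deep χ k z) :
    ∃ D ∈ P.level χ k, (D : Set (Grid d)) = P.component χ k z := by
  have hfin : (P.component χ k z).Finite :=
    (finite_near (2 * P.r k + P.drift k) z).subset fun v hv => region_near (hz.component_subset hv)
  exact ⟨hfin.toFinset, ⟨z, hz, by simp⟩, by simp⟩

/-- All vertices of a piece are close to each other. -/
theorem near_of_mem_level (hD : D ∈ P.level χ k) (hx : x ∈ D) (hy : y ∈ D) :
    Near (4 * P.r k + 2 * P.drift k) x y := by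
  obtain ⟨z, hz, hDz⟩ := hD
  have hx' : x ∈ P.component χ k z := hDz ▸ hx
  have hy' : y ∈ P.component χ k z := hDz ▸ hy
  exact (region_near (hz.component_subset hx')).symm.trans
    (region_near (hz.component_subset hy')) (by omega)

theorem isPiece_of_mem_level (hD : D ∈ P.level χ k) : IsPiece D := by
  obtain ⟨z, hz, hDz⟩ := hD
  have hzD : z ∈ (D : Set (Grid d)) := hDz ▸ self_mem_component
  have key : ∀ v (hv : v ∈ (D : Set (Grid d))),
      ((gridGraph d).induce (D : Set (Grid d))).Reachable ⟨z, hzD⟩ ⟨v, hv⟩ := by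
    intro v hv
    have hv' : v ∈ P.component χ k z := hDz ▸ hv
    change Relation.ReflTransGen _ z v at hv'
    induction hv' with
    | refl => exact SimpleGraph.Reachable.refl _
    | @tail b c h1 h2 ih =>
      have hb : b ∈ (D : Set (Grid d)) := hDz ▸ (h1 : b ∈ P.component χ k z)
      refine (ih hb).trans (SimpleGraph.Adj.reachable ?_)
      exact h2.1
  have : Nonempty (D : Set (Grid d)) := ⟨⟨z, hzD⟩⟩
  exact ⟨fun a b => (key a.1 a.2).symm.trans (key b.1 b.2)⟩

/-- The region carrying `D` is a single fibre of `retract χ l`. The region of `E` meets this fibre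
at `x`, hence contains it, and connectedness of `D` keeps it in the component of `x`. -/
theorem subset_of_level_lt (hkl : k < l) (hD : D ∈ P.level χ k) (hE : E ∈ P.level χ l)
    (hx : x ∈ D) (hx' : x ∈ E) : D ⊆ E := by
  obtain ⟨z, hz, hDz⟩ := hD
  obtain ⟨z', hz', hEz⟩ := hE
  have hxD : x ∈ P.component χ k z := hDz ▸ hx
  have hxE : x ∈ P.component χ l z' := hEz ▸ hx'
  have hreg : P.region χ k z ⊆ P.region χ l z' := fun v hv =>
    mem_region_of_retract_eq
      (retract_eq_of_le hkl (retract_succ_eq_of_mem (hz.component_subset hxD) hv))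
      (hz'.component_subset hxE)
  intro v hv
  have hvD : v ∈ P.component χ k z := hDz ▸ hv
  have hpath : Relation.ReflTransGen (StepIn (P.region χ k z)) x v :=
    (reflTransGen_stepIn_symm hz.mem_region hxD).trans hvD
  have hv' : v ∈ P.component χ l z' :=
    Relation.ReflTransGen.trans hxE
      (Relation.ReflTransGen.mono (fun a b hab => ⟨hab.1, hreg hab.2⟩) _ _ hpath)
  exact Finset.mem_coe.1 (hEz ▸ hv')

/-- The margin puts the images of `x` and `y` in one cell, and a cell carries at most one piece. -/
theorem eq_of_level_eq_of_near (hD : D ∈ P.level χ k) (hE : E ∈ P.level χ k)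
    (hx : x ∈ D) (hy : y ∈ E) (h : Near (P.q + 1) x y) : D = E := by
  obtain ⟨z, hz, hDz⟩ := hD
  obtain ⟨z', hz', hEz⟩ := hE
  have hxD : x ∈ P.component χ k z := hDz ▸ hx
  have hyE : y ∈ P.component χ k z' := hEz ▸ hy
  have h1 := hz.component_subset hxD
  have h2 := hz'.component_subset hyE
  have : SameCell (P.r k) (P.m k) (χ k) z z' :=
    (h1.2.trans (sameCell_retract_of_near h1 h)).trans h2.2.symm
  rw [← Finset.coe_inj, hDz, hEz, hz.component_eq hz' this]

/-- Otherwise `y` and its outer neighbour `w` are both within `q + 1` of `x`, hence in one fibre of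
`retract χ l`. Then `w` is in the region of `E` and adjacent to `y ∈ E`, so it is in `E`. -/
theorem not_near_boundary (hkl : k < l) (hD : D ∈ P.level χ k) (hE : E ∈ P.level χ l)
    (hx : x ∈ D) (hy : y ∈ boundary E) : ¬ Near P.q x y := by
  intro h
  obtain ⟨hyE, w, hw, hadj⟩ := hy
  obtain ⟨z, hz, hDz⟩ := hD
  obtain ⟨z', hz', hEz⟩ := hE
  have hxD : x ∈ P.component χ k z := hDz ▸ hx
  have hyE' : y ∈ P.component χ l z' := hEz ▸ hyE
  have hxr := hz.component_subset hxD
  have e1 : P.retract χ l y = P.retract χ l w := retract_eq_of_le hkl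
    ((retract_succ_eq_of_near hxr (h.mono (by omega))).symm.trans
      (retract_succ_eq_of_near hxr (h.trans (near_one_of_adj hadj) le_rfl)))
  have hw' : w ∈ P.component χ l z' := Relation.ReflTransGen.tail hyE'
    ⟨hadj, mem_region_of_retract_eq e1 (hz'.component_subset hyE')⟩
  exact hw (Finset.mem_coe.1 (hEz ▸ hw'))

/-- The pieces of all levels form a toast as soon as arbitrarily large neighbourhoods of the origin
are deep inside cells. -/
theorem isToast (h : ∀ M, ∃ k, Inner (P.r k) (P.m k) (χ k) (P.depth k + M) (0 : Grid d)) :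
    IsToast P.q (P.toast χ) where
  isPiece := fun D ⟨k, hD⟩ => isPiece_of_mem_level hD
  cover := by
    intro g g'
    obtain ⟨k, hk⟩ := h (gridDist g 0 + gridDist g' 0)
    have hd0 : P.Deep χ k (0 : Grid d) := hk.mono (by omega)
    obtain ⟨D, hD, hD0⟩ := hd0.exists_mem_level
    have key : ∀ x : Grid d, gridDist x 0 ≤ gridDist g 0 + gridDist g' 0 → x ∈ D := by
      intro x hx
      have hnear := (near_of_gridDist_le hx).symm
      have hdx : P.Deep χ k x := hk.of_near hnear (by omega)
      have hcell : SameCell (P.r k) (P.m k) (χ k) 0 x := hk x (hnear.mono (by omega))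
      rw [← Finset.mem_coe, hD0, hd0.component_eq hdx hcell]
      exact self_mem_component
    exact ⟨D, ⟨k, hD⟩, key g (by omega), key g' (by omega)⟩
  separated := by
    rintro D ⟨k, hD⟩ E ⟨l, hE⟩ ⟨u, hu, v, hv, huv⟩
    have hn := near_of_gridDist_le huv
    rcases lt_trichotomy k l with hkl | rfl | hkl
    · exact absurd hn (not_near_boundary hkl hD hE hu.1 hv)
    · exact eq_of_level_eq_of_near hD hE hu.1 hv.1 (hn.mono (by omega))
    · exact absurd hn.symm (not_near_boundary hkl hE hD hv.1 hu)
  laminar := by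
    rintro D ⟨k, hD⟩ E ⟨l, hE⟩
    by_cases hdis : Disjoint D E
    · exact Or.inr (Or.inr hdis)
    obtain ⟨x, hx, hx'⟩ := Finset.not_disjoint_iff.1 hdis
    rcases lt_trichotomy k l with hkl | rfl | hkl
    · exact Or.inl (subset_of_level_lt hkl hD hE hx hx')
    · exact Or.inl (eq_of_level_eq_of_near hD hE hx hx' (Near.refl _ _)).subset
    · exact Or.inr (Or.inl (subset_of_level_lt hkl hE hD hx' hx))

/-! #### Equivariance -/

theorem retract_shift (g : Grid d) (k : ℕ) (v : Grid d) :
    P.retract (fun k j v => χ k j (v + g)) k v + g = P.retract χ k (v + g) := by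
  induction k with
  | zero => rfl
  | succ k ih =>
    change collapse (P.r k) (P.m k) (fun j v => χ k j (v + g)) _ + g = _
    rw [collapse_shift, ih]
    rfl

theorem region_shift (g : Grid d) :
    v ∈ P.region (fun k j v => χ k j (v + g)) k z ↔ v + g ∈ P.region χ k (z + g) := by
  change Inner (P.r k) (P.m k) (fun j v => χ k j (v + g)) _ _ ∧
    SameCell (P.r k) (P.m k) (fun j v => χ k j (v + g)) _ _ ↔ _
  rw [inner_shift, sameCell_shift, retract_shift]
  rfl

theorem component_shift (g : Grid d) :
    v ∈ P.component (fun k j v => χ k j (v + g)) k z ↔ v + g ∈ P.component χ k (z + g) := by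
  constructor
  · intro h
    exact Relation.ReflTransGen.lift (· + g)
      (fun a b hab => ⟨(gridGraph_adj_add_right g).2 hab.1, (region_shift g).1 hab.2⟩) _ _ h
  · intro h
    have := Relation.ReflTransGen.lift (p := StepIn (P.region (fun k j v => χ k j (v + g)) k z))
      (· - g) (fun a b hab => ?_) _ _ h
    · simp only [Function.onFun, add_sub_cancel_right] at this
      exact this
    · refine ⟨?_, (region_shift g).2 (by simpa using hab.2)⟩
      rw [← gridGraph_adj_add_right g]
      simpa using hab.1

theorem deep_shift (g : Grid d) :
    P.Deep (fun k j v => χ k j (v + g)) k z ↔ P.Deep χ k (z + g) :=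
  inner_shift g

end Scales

theorem mem_shiftSet {g v : Grid d} {D : Finset (Grid d)} : v + g ∈ shiftSet g D ↔ v ∈ D := by
  simp [shiftSet]

theorem mem_shiftSet' {g v : Grid d} {D : Finset (Grid d)} : v ∈ shiftSet g D ↔ v - g ∈ D := by
  rw [← mem_shiftSet (g := g) (v := v - g), sub_add_cancel]

theorem shiftSet_shiftSet (g h : Grid d) (D : Finset (Grid d)) :
    shiftSet g (shiftSet h D) = shiftSet (h + g) D := by
  ext v; simp [mem_shiftSet', sub_sub, add_comm g h]

theorem shiftSet_zero (D : Finset (Grid d)) : shiftSet 0 D = D := by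
  ext v; simp [mem_shiftSet']

theorem shiftSet_shiftSet_neg (g : Grid d) (D : Finset (Grid d)) :
    shiftSet g (shiftSet (-g) D) = D := by
  rw [shiftSet_shiftSet, neg_add_cancel, shiftSet_zero]

namespace Scales

variable {P : Scales} {χ : Marks d} {k l : ℕ} {x y z v w : Grid d} {D E : Finset (Grid d)}

theorem mem_level_shift (g : Grid d) :
    D ∈ P.level (fun k j v => χ k j (v + g)) k ↔ shiftSet g D ∈ P.level χ k := by
  have key : ∀ z, ((D : Set (Grid d)) = P.component (fun k j v => χ k j (v + g)) k z ↔
      (shiftSet g D : Set (Grid d)) = P.component χ k (z + g)) := by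
    intro z
    constructor
    · intro h
      ext v
      rw [← sub_add_cancel v g, ← component_shift, ← h, Finset.mem_coe, Finset.mem_coe, mem_shiftSet]
    · intro h
      ext v
      rw [component_shift, ← h, Finset.mem_coe, Finset.mem_coe, mem_shiftSet]
  constructor
  · rintro ⟨z, hz, h⟩
    exact ⟨z + g, (deep_shift g).1 hz, (key z).1 h⟩
  · rintro ⟨z, hz, h⟩
    refine ⟨z - g, (deep_shift g).2 (by simpa using hz), (key _).2 (by simpa using h)⟩

theorem mem_levelsUpTo_shift (g : Grid d) :
    D ∈ P.levelsUpTo (fun k j v => χ k j (v + g)) k ↔ shiftSet g D ∈ P.levelsUpTo χ k := by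
  simp only [levelsUpTo, Set.mem_ofPred_eq, mem_level_shift]

/-! #### Locality -/

theorem retract_congr {χ χ' : Marks d} {M N k : ℕ} (hN : ∀ l ≤ k, M + P.drift l + 5 * P.r l ≤ N)
    (h : ∀ l ≤ k, ∀ j < P.m l, ∀ w, Near N 0 w → χ l j w = χ' l j w) (hv : Near M 0 v)
    (hlk : l ≤ k + 1) : P.retract χ l v = P.retract χ' l v := by
  induction l with
  | zero => rfl
  | succ l ih =>
    change collapse _ _ _ _ = collapse _ _ _ _
    rw [← ih (by omega)]
    refine collapse_congr fun j hj w hw => h l (by omega) j hj w ?_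
    have := hN l (by omega)
    exact (hv.trans (near_retract χ l v) le_rfl).trans hw (by omega)

theorem mem_region_congr {χ χ' : Marks d} {M N k : ℕ}
    (hN : ∀ l ≤ k, M + P.drift l + 5 * P.r l ≤ N)
    (h : ∀ l ≤ k, ∀ j < P.m l, ∀ w, Near N 0 w → χ l j w = χ' l j w) (hv : Near M 0 v)
    (hlk : l ≤ k) (hmem : v ∈ P.region χ l z) : v ∈ P.region χ' l z := by
  have hr := retract_congr hN h hv (l := l) (by omega)
  have hagree : ∀ j < P.m l, ∀ w, Near (5 * P.r l) (P.retract χ l v) w → χ l j w = χ' l j w := by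
    intro j hj w hw
    have := hN l hlk
    exact h l hlk j hj w ((hv.trans (near_retract χ l v) le_rfl).trans hw (by omega))
  unfold region at *
  rw [Set.mem_ofPred_eq] at *
  rw [← hr]
  exact ⟨(inner_congr hagree).1 hmem.1, (hmem.2.symm.congr hagree).symm⟩

/-- Recognising a component requires the marks that decide membership in the region for its vertices
and for their outer neighbours. -/
theorem mem_level_of_agree {χ χ' : Marks d} {M N k : ℕ}
    (hN : ∀ l ≤ k, M + 1 + P.drift l + 5 * P.r l ≤ N)
    (h : ∀ l ≤ k, ∀ j < P.m l, ∀ w, Near N 0 w → χ l j w = χ' l j w)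
    (hD : ∀ v ∈ D, Near M 0 v) (hlk : l ≤ k) (hmem : D ∈ P.level χ l) : D ∈ P.level χ' l := by
  obtain ⟨z, hz, hDz⟩ := hmem
  have hcomp : ∀ v ∈ P.component χ l z, Near M 0 v := fun v hv => hD v (Finset.mem_coe.1 (hDz ▸ hv))
  have hz0 : Near M 0 z := hcomp z self_mem_component
  have h' : ∀ l ≤ k, ∀ j < P.m l, ∀ w, Near N 0 w → χ' l j w = χ l j w :=
    fun l hl j hj w hw => (h l hl j hj w hw).symm
  have hdeep : P.Deep χ' l z := by
    refine (inner_congr fun j hj w hw => ?_).1 hz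
    have := hN l hlk
    exact h l hlk j hj w (hz0.trans hw (by omega))
  refine ⟨z, hdeep, ?_⟩
  rw [hDz]
  ext v
  constructor
  · intro hv
    change Relation.ReflTransGen _ z v at hv
    induction hv with
    | refl => exact self_mem_component
    | @tail b c h1 h2 ih =>
      refine Relation.ReflTransGen.tail ih ⟨h2.1, ?_⟩
      exact mem_region_congr hN h ((hcomp c (h1.tail h2)).mono (by omega)) hlk h2.2
  · intro hv
    change Relation.ReflTransGen _ z v at hv
    induction hv with
    | refl => exact self_mem_component
    | @tail b c h1 h2 ih =>
      refine Relation.ReflTransGen.tail ih ⟨h2.1, ?_⟩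
      -- Here `c` is only known to be adjacent to a vertex of `D`; this is the reason for `M + 1` in
      -- `hN`.
      exact mem_region_congr hN h' ((hcomp b ih).trans (near_one_of_adj h2.1) le_rfl) hlk h2.2

end Scales

/-! ### The probability that a vertex is not deep inside a cell -/

/-- The vertices at sup-distance at most `n` from the origin. -/
noncomputable def box (d n : ℕ) : Finset (Grid d) := Fintype.piFinset fun _ => Finset.Icc (-(n : ℤ)) n

theorem mem_box {n : ℕ} {u : Grid d} : u ∈ box d n ↔ Near n 0 u := by
  simp only [box, Fintype.mem_piFinset, Finset.mem_Icc, Near, Pi.zero_apply]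
  exact forall_congr' fun a => by omega

theorem card_box (n : ℕ) : (box d n).card = (2 * n + 1) ^ d := by
  have : ((n : ℤ) + 1 + n).toNat = 2 * n + 1 := by omega
  simp [box, this]

theorem box_mono {n m : ℕ} (h : n ≤ m) : box d n ⊆ box d m := fun _ hu =>
  mem_box.2 ((mem_box.1 hu).mono h)

/-- Some centre is so close to the origin that the origin is deep inside its cube. -/
def hitSet (d r s : ℕ) : Set (Grid d → Bool) := {χ | ∃ u, IsCenter r χ u ∧ Near (r - s) u 0}

open Classical in
/-- Some marked vertex has a cube whose bounding hyperplanes come close to the origin. -/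
noncomputable def cutSet (d r s : ℕ) : Set (Grid d → Bool) :=
  ⋃ w ∈ (box d (3 * r)).filter (fun w => Cuts r s w 0), {χ | χ w = true}

/-- No round hits the origin, or some round cuts it before it is hit. -/
def badSet (d r m s : ℕ) : Set (ℕ → Grid d → Bool) :=
  {χ | ∀ j < m, χ j ∉ hitSet d r s} ∪
    ⋃ j ∈ Finset.range m, {χ | χ j ∈ cutSet d r s ∧ ∀ l < j, χ l ∉ hitSet d r s}

theorem inner_of_notMem_badSet {r m s : ℕ} (hs : s ≤ r) {χ : ℕ → Grid d → Bool}
    (h : χ ∉ badSet d r m s) : Inner r m χ s 0 := by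
  simp only [badSet, Set.mem_union, Set.mem_iUnion, Finset.mem_range, not_or,
    not_exists] at h
  obtain ⟨h1, h2⟩ := h
  have hex : ∃ j, j < m ∧ χ j ∈ hitSet d r s := by
    by_contra! hc
    exact h1 hc
  classical
  -- The first round that hits the origin captures it. Earlier rounds neither hit nor cut, since a
  -- cut in such a round is part of `badSet`.
  obtain ⟨hi, u, hu, hu0⟩ := Nat.find_spec hex
  have hmin : ∀ j < Nat.find hex, χ j ∉ hitSet d r s := fun j hj hh =>
    Nat.find_min hex hj ⟨hj.trans hi, hh⟩
  refine inner_of_captures_of_not_cuts hs hi hu hu0 (fun j hj w hw hwx => hmin j hj ⟨w, hw, hwx⟩) ?_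
  intro j hj w hw hwx hcut
  refine h2 j (hj.trans hi) ⟨?_, fun l hl => hmin l (hl.trans hj)⟩
  simp only [cutSet, Set.mem_iUnion, Finset.mem_filter]
  exact ⟨w, ⟨mem_box.2 hwx.symm, hcut⟩, hw.1⟩

theorem measurableSet_mark (w : Grid d) (b : Bool) : MeasurableSet {χ : Grid d → Bool | χ w = b} :=
  have h : MeasurableSet ((fun χ : Grid d → Bool => χ w) ⁻¹' {b}) :=
    measurable_pi_apply w (measurableSet_singleton b)
  h

theorem measurableSet_hitSet (d r s : ℕ) : MeasurableSet (hitSet d r s) := by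
  have h1 : ∀ w : Grid d, Measurable fun χ : Grid d → Bool => χ w = true := fun w =>
    measurableSet_setOfPred.1 (measurableSet_mark w true)
  refine measurableSet_setOfPred.2 (Measurable.exists fun u => Measurable.and (Measurable.and (h1 u)
    (Measurable.forall fun w => ?_)) measurable_const)
  exact Measurable.imp measurable_const (Measurable.imp (h1 w) measurable_const)

theorem measurableSet_cutSet (d r s : ℕ) : MeasurableSet (cutSet d r s) :=
  Finset.measurableSet_biUnion _ fun w _ => measurableSet_mark w true

theorem measurableSet_badSet (d r m s : ℕ) : MeasurableSet (badSet d r m s) := by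
  have h1 : ∀ j : ℕ, MeasurableSet {χ : ℕ → Grid d → Bool | ∀ l < j, χ l ∉ hitSet d r s} := by
    intro j
    have : MeasurableSet (Set.pi (Set.Iio j) fun _ : ℕ => (hitSet d r s)ᶜ) :=
      MeasurableSet.pi (Set.to_countable _) fun _ _ => (measurableSet_hitSet d r s).compl
    exact this
  refine MeasurableSet.union (h1 m) (Finset.measurableSet_biUnion _ fun j _ => ?_)
  have h2 : MeasurableSet ((fun χ : ℕ → Grid d → Bool => χ j) ⁻¹' cutSet d r s) :=
    measurable_pi_apply j (measurableSet_cutSet d r s)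
  exact h2.inter (h1 j)

/-- The probability with which a vertex is marked at a level with cubes of radius `r`. -/
noncomputable def markProb (d r : ℕ) : ℝ := 1 / (2 * (6 * r + 1) ^ d)

theorem markProb_pos (d r : ℕ) : 0 < markProb d r := by unfold markProb; positivity

theorem markProb_le_one (d r : ℕ) : markProb d r ≤ 1 := by
  unfold markProb
  rw [div_le_one (by positivity)]
  have : (1 : ℝ) ≤ (6 * r + 1) ^ d := one_le_pow₀ (by linarith [Nat.cast_nonneg (α := ℝ) r])
  linarith

/-! ### Estimates for one scale with independent marks -/

section

variable {r s m : ℕ} {β : Measure Bool} [IsProbabilityMeasure β]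

theorem measure_false_eq (hβ : β {true} = ENNReal.ofReal (markProb d r)) :
    β {false} = ENNReal.ofReal (1 - markProb d r) := by
  have : ({false} : Set Bool) = {true}ᶜ := by ext b; cases b <;> simp
  rw [this, prob_compl_eq_one_sub (measurableSet_singleton _), hβ,
    ENNReal.ofReal_sub _ (markProb_pos d r).le, ENNReal.ofReal_one]

open Classical in
-- The events that `u` is the only mark in the box of radius `3 * r`, for `u` in the box of radius
-- `r - s`, are disjoint and each forces a hit. Each has probability at least `p / 2`, and since `2
-- * s ≤ r` there are at least `((6 * r + 1) / 6) ^ d` of them.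
theorem measure_hitSet_ge (hs : 2 * s ≤ r) (hβ : β {true} = ENNReal.ofReal (markProb d r)) :
    ENNReal.ofReal (1 / (4 * 6 ^ d)) ≤
      Measure.infinitePi (fun _ : Grid d => β) (hitSet d r s) := by
  set p := markProb d r with hp
  have hp0 : 0 < p := markProb_pos d r
  have hp1 : p ≤ 1 := markProb_le_one d r
  let T : Grid d → Grid d → Set Bool := fun u w => if w = u then {true} else {false}
  let E : Grid d → Set (Grid d → Bool) := fun u => Set.pi (box d (3 * r)) (T u)
  have hT : ∀ u w, MeasurableSet (T u w) := fun u w => MeasurableSet.of_discrete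
  have hEm : ∀ u, MeasurableSet (E u) := fun u =>
    MeasurableSet.pi (Finset.countable_toSet _) fun w _ => hT u w
  have hmem : ∀ u ∈ box d (r - s), u ∈ box d (3 * r) := fun u hu => box_mono (by omega) hu
  have hEu : ∀ u ∈ box d (r - s), ∀ χ ∈ E u, χ u = true ∧ ∀ w ∈ box d (3 * r), χ w = true → w = u := by
    intro u hu χ hχ
    refine ⟨by simpa [T] using hχ u (hmem u hu), fun w hw hχw => ?_⟩
    by_contra hne
    have := hχ w hw
    simp [T, hne, hχw] at this
  have hsub : (⋃ u ∈ box d (r - s), E u) ⊆ hitSet d r s := by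
    intro χ hχ
    simp only [Set.mem_iUnion] at hχ
    obtain ⟨u, hu, hχ⟩ := hχ
    obtain ⟨h1, h2⟩ := hEu u hu χ hχ
    have hu0 := mem_box.1 hu
    exact ⟨u, ⟨h1, fun w hw => h2 w (mem_box.2 (hu0.trans hw (by omega)))⟩, hu0.symm⟩
  have hdisj : (box d (r - s) : Set (Grid d)).PairwiseDisjoint E := by
    intro u hu v hv huv
    refine Set.disjoint_left.2 fun χ h1 h2 => huv ?_
    exact (hEu v hv χ h2).2 u (hmem u hu) (hEu u hu χ h1).1
  have hE : ∀ u ∈ box d (r - s), ENNReal.ofReal (p / 2) ≤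
      Measure.infinitePi (fun _ : Grid d => β) (E u) := by
    intro u hu
    rw [Measure.infinitePi_pi _ fun w _ => hT u w, ← Finset.mul_prod_erase _ _ (hmem u hu)]
    rw [Finset.prod_congr rfl (g := fun _ => ENNReal.ofReal (1 - p)) fun w hw => by
      simp only [T, if_neg (Finset.ne_of_mem_erase hw)]; exact measure_false_eq hβ]
    simp only [T, if_true, hβ]
    rw [Finset.prod_const, ← ENNReal.ofReal_pow (by linarith), ← ENNReal.ofReal_mul hp0.le]
    refine ENNReal.ofReal_le_ofReal ?_
    have hcard : (((box d (3 * r)).erase u).card : ℝ) ≤ (6 * r + 1) ^ d := by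
      have h1 : ((box d (3 * r)).erase u).card ≤ (box d (3 * r)).card := Finset.card_erase_le
      rw [card_box] at h1
      have h2 : ((((box d (3 * r)).erase u).card : ℕ) : ℝ) ≤ (((2 * (3 * r) + 1) ^ d : ℕ) : ℝ) := by
        exact_mod_cast h1
      refine h2.trans (le_of_eq ?_)
      push_cast; ring
    -- Bernoulli's inequality: the box has `(6 * r + 1) ^ d` vertices and `markProb` makes the
    -- expected number of marks in it `1 / 2`, so it is free of other marks with probability at
    -- least `1 / 2`.
    have hbern := one_add_mul_le_pow (a := -p) (by linarith) ((box d (3 * r)).erase u).card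
    have hpN : (6 * (r : ℝ) + 1) ^ d * p = 1 / 2 := by
      rw [hp, markProb]; field_simp
    have : (((box d (3 * r)).erase u).card : ℝ) * p ≤ 1 / 2 := by
      rw [← hpN]; exact mul_le_mul_of_nonneg_right hcard hp0.le
    have h3 : (1 : ℝ) / 2 ≤ (1 - p) ^ ((box d (3 * r)).erase u).card := by
      have h4 : (1 + -p) = 1 - p := by ring
      rw [h4] at hbern
      linarith
    nlinarith
  calc ENNReal.ofReal (1 / (4 * 6 ^ d))
      ≤ ENNReal.ofReal ((2 * (r - s : ℕ) + 1) ^ d * (p / 2)) := by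
        refine ENNReal.ofReal_le_ofReal ?_
        have h1 : (6 * (r : ℝ) + 1) ^ d ≤ 6 ^ d * (2 * (r - s : ℕ) + 1) ^ d := by
          rw [← mul_pow]
          refine pow_le_pow_left₀ (by positivity) ?_ d
          have : 6 * r + 1 ≤ 6 * (2 * (r - s) + 1) := by omega
          exact_mod_cast this
        rw [hp, markProb, div_div, ← mul_div_assoc, mul_one, div_le_div_iff₀ (by positivity)
          (by positivity)]
        nlinarith
    _ = ∑ _u ∈ box d (r - s), ENNReal.ofReal (p / 2) := by
        rw [Finset.sum_const, card_box, nsmul_eq_mul, ENNReal.ofReal_mul (by positivity)]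
        congr 1
        rw [← ENNReal.ofReal_natCast]
        push_cast; rfl
    _ ≤ ∑ u ∈ box d (r - s), Measure.infinitePi (fun _ : Grid d => β) (E u) := Finset.sum_le_sum hE
    _ = Measure.infinitePi (fun _ : Grid d => β) (⋃ u ∈ box d (r - s), E u) :=
        (measure_biUnion_finset hdisj fun u _ => hEm u).symm
    _ ≤ _ := measure_mono hsub

theorem measure_hitSet_compl_le (hs : 2 * s ≤ r)
    (hβ : β {true} = ENNReal.ofReal (markProb d r)) :
    Measure.infinitePi (fun _ : Grid d => β) (hitSet d r s)ᶜ ≤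
      ENNReal.ofReal (1 - 1 / (4 * 6 ^ d)) := by
  rw [prob_compl_eq_one_sub (measurableSet_hitSet d r s), ENNReal.ofReal_sub _ (by positivity),
    ENNReal.ofReal_one]
  exact tsub_le_tsub_left (measure_hitSet_ge hs hβ) _

open Classical in
-- One coordinate of `w` is confined to two windows of length `2 * s` around `r` and `-r`; the
-- others range over `6 * r + 1` values.
theorem card_filter_cuts_le (d r s : ℕ) :
    ((box d (3 * r)).filter (fun w => Cuts r s w 0)).card ≤ d * (4 * s * (6 * r + 1) ^ (d - 1)) := by
  let S : Finset ℤ := Finset.Ioc ((r : ℤ) - s) (r + s) ∪ Finset.Ico (-(r : ℤ) - s) (-r + s)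
  have hS : S.card ≤ 4 * s := by
    refine (Finset.card_union_le _ _).trans ?_
    simp only [Int.card_Ioc, Int.card_Ico]
    omega
  let I : Finset ℤ := Finset.Icc (-((3 * r : ℕ) : ℤ)) ((3 * r : ℕ) : ℤ)
  have hI : I.card = 6 * r + 1 := by simp only [I, Int.card_Icc]; omega
  let F : Fin d → Finset (Grid d) := fun a => Fintype.piFinset (Function.update (fun _ => I) a S)
  have hF : ∀ a, (F a).card ≤ 4 * s * (6 * r + 1) ^ (d - 1) := by
    intro a
    rw [Fintype.card_piFinset, ← Finset.mul_prod_erase _ _ (Finset.mem_univ a), Function.update_self]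
    rw [Finset.prod_congr rfl (g := fun _ => 6 * r + 1) fun b hb => by
      rw [Function.update_of_ne (Finset.ne_of_mem_erase hb), hI]]
    rw [Finset.prod_const, Finset.card_erase_of_mem (Finset.mem_univ a), Finset.card_univ,
      Fintype.card_fin]
    exact Nat.mul_le_mul_right _ hS
  have hsub : (box d (3 * r)).filter (fun w => Cuts r s w 0) ⊆ Finset.univ.biUnion F := by
    intro w hw
    obtain ⟨hw, a, ha⟩ := Finset.mem_filter.1 hw
    refine Finset.mem_biUnion.2 ⟨a, Finset.mem_univ a, Fintype.mem_piFinset.2 fun b => ?_⟩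
    by_cases hb : b = a
    · subst hb
      rw [Function.update_self]
      simp only [S, Finset.mem_union, Finset.mem_Ioc, Finset.mem_Ico]
      simp only [Pi.zero_apply] at ha
      omega
    · rw [Function.update_of_ne hb]
      exact Fintype.mem_piFinset.1 hw b
  calc _ ≤ _ := Finset.card_le_card hsub
    _ ≤ ∑ a, (F a).card := Finset.card_biUnion_le
    _ ≤ ∑ _a : Fin d, 4 * s * (6 * r + 1) ^ (d - 1) := Finset.sum_le_sum fun a _ => hF a
    _ = _ := by simp

/-- Union bound over all marks, isolated or not: the number of positions times the density leaves
surface over volume. -/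
theorem measure_cutSet_le (hr : 0 < r) (hβ : β {true} = ENNReal.ofReal (markProb d r)) :
    Measure.infinitePi (fun _ : Grid d => β) (cutSet d r s) ≤ ENNReal.ofReal (d * s / r) := by
  classical
  have h1 : ∀ w : Grid d, Measure.infinitePi (fun _ : Grid d => β) {χ | χ w = true} =
      ENNReal.ofReal (markProb d r) := by
    intro w
    rw [← hβ]
    exact (measurePreserving_eval_infinitePi (fun _ : Grid d => β) w).measure_preimage
      (measurableSet_singleton true).nullMeasurableSet
  refine (measure_biUnion_finset_le _ _).trans ?_
  simp only [h1]
  rw [Finset.sum_const, nsmul_eq_mul, ← ENNReal.ofReal_natCast,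
    ← ENNReal.ofReal_mul (Nat.cast_nonneg _)]
  refine ENNReal.ofReal_le_ofReal ?_
  rcases Nat.eq_zero_or_pos d with rfl | hd
  · have : ((box 0 (3 * r)).filter (fun w => Cuts r s w 0)).card = 0 :=
      Nat.le_zero.1 ((card_filter_cuts_le 0 r s).trans (by simp))
    rw [this]; simp
  have hc : ((((box d (3 * r)).filter (fun w => Cuts r s w 0)).card : ℕ) : ℝ) ≤
      d * (4 * s * (6 * r + 1) ^ (d - 1)) := by exact_mod_cast card_filter_cuts_le d r s
  have hr' : (0 : ℝ) < r := by exact_mod_cast hr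
  calc _ ≤ (d : ℝ) * (4 * s * (6 * r + 1) ^ (d - 1)) * markProb d r :=
        mul_le_mul_of_nonneg_right hc (markProb_pos d r).le
    _ = d * s * (2 / (6 * r + 1)) := by
        obtain ⟨e, rfl⟩ : ∃ e, d = e + 1 := ⟨d - 1, by omega⟩
        rw [markProb, Nat.add_sub_cancel, pow_succ]
        field_simp
        ring
    _ ≤ d * s * (1 / r) := by
        refine mul_le_mul_of_nonneg_left ?_ (by positivity)
        rw [div_le_div_iff₀ (by positivity) hr']
        linarith
    _ = d * s / r := by ring

open Classical in
-- By independence of the rounds, round `j` is the harmful one with probability at most `(d * s / r)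
-- * (1 - c) ^ j`. The geometric sum does not depend on `m`, so `m` may be taken so large that the
-- event of never being hit is negligible as well.
theorem measure_badSet_le (hr : 0 < r) (hs : 2 * s ≤ r)
    (hm : (1 - 1 / (4 * 6 ^ d) : ℝ) ^ m ≤ s / r)
    (hβ : β {true} = ENNReal.ofReal (markProb d r)) :
    Measure.infinitePi (fun _ : ℕ => Measure.infinitePi (fun _ : Grid d => β)) (badSet d r m s) ≤
      ENNReal.ofReal ((1 + 4 * 6 ^ d * d) * s / r) := by
  set ν := Measure.infinitePi (fun _ : Grid d => β) with hν
  set c : ℝ := 1 / (4 * 6 ^ d) with hc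
  have hc0 : 0 < c := by positivity
  have hc1 : c ≤ 1 := by
    rw [hc, div_le_one (by positivity)]
    have : (1 : ℝ) ≤ 6 ^ d := one_le_pow₀ (by norm_num)
    linarith
  have hhit : ν (hitSet d r s)ᶜ ≤ ENNReal.ofReal (1 - c) := measure_hitSet_compl_le hs hβ
  have hcut : ν (cutSet d r s) ≤ ENNReal.ofReal (d * s / r) := measure_cutSet_le hr hβ
  have h1 : Measure.infinitePi (fun _ : ℕ => ν) {χ | ∀ j < m, χ j ∉ hitSet d r s} ≤
      ENNReal.ofReal ((1 - c) ^ m) := by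
    have : {χ : ℕ → Grid d → Bool | ∀ j < m, χ j ∉ hitSet d r s} =
        Set.pi (Finset.range m) fun _ => (hitSet d r s)ᶜ := by
      ext χ; simp [Set.mem_pi]
    rw [this, Measure.infinitePi_pi _ fun _ _ => (measurableSet_hitSet d r s).compl,
      Finset.prod_const, Finset.card_range, ENNReal.ofReal_pow (by linarith)]
    exact pow_le_pow_left' hhit m
  have h2 : ∀ j, Measure.infinitePi (fun _ : ℕ => ν)
      {χ | χ j ∈ cutSet d r s ∧ ∀ l < j, χ l ∉ hitSet d r s} ≤
      ENNReal.ofReal (d * s / r * (1 - c) ^ j) := by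
    intro j
    let T : ℕ → Set (Grid d → Bool) := fun l => if l = j then cutSet d r s else (hitSet d r s)ᶜ
    have : {χ : ℕ → Grid d → Bool | χ j ∈ cutSet d r s ∧ ∀ l < j, χ l ∉ hitSet d r s} =
        Set.pi (Finset.range (j + 1)) T := by
      ext χ
      simp only [Set.mem_ofPred_eq, Set.mem_pi, Finset.coe_range, Set.mem_Iio, T]
      constructor
      · rintro ⟨h1, h2⟩ l hl
        by_cases hlj : l = j
        · subst hlj; simpa using h1
        · simpa [hlj] using h2 l (by omega)
      · intro h
        refine ⟨by simpa using h j (by omega), fun l hl => ?_⟩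
        have := h l (by omega)
        rwa [if_neg (by omega)] at this
    have hTm : ∀ l, MeasurableSet (T l) := by
      intro l
      by_cases hlj : l = j
      · simpa [T, hlj] using measurableSet_cutSet d r s
      · simpa [T, hlj] using measurableSet_hitSet d r s
    rw [this, Measure.infinitePi_pi _ fun l _ => hTm l, Finset.prod_range_succ,
      Finset.prod_congr rfl (g := fun _ => ν (hitSet d r s)ᶜ) fun l hl => by
        simp only [T, if_neg (Finset.mem_range.1 hl).ne]]
    simp only [T, if_true]
    rw [Finset.prod_const, Finset.card_range, mul_comm, ENNReal.ofReal_mul (by positivity),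
      ENNReal.ofReal_pow (by linarith)]
    exact mul_le_mul' hcut (pow_le_pow_left' hhit j)
  have hgeom : ∑ j ∈ Finset.range m, (1 - c) ^ j ≤ 1 / c := by
    rw [le_div_iff₀ hc0]
    have h3 := geom_sum_mul (1 - c) m
    have h4 : 0 ≤ (1 - c) ^ m := pow_nonneg (by linarith) m
    nlinarith
  calc _ ≤ ENNReal.ofReal ((1 - c) ^ m) +
        ∑ j ∈ Finset.range m, ENNReal.ofReal (d * s / r * (1 - c) ^ j) := by
        refine (measure_union_le _ _).trans (add_le_add h1 ?_)
        exact (measure_biUnion_finset_le _ _).trans (Finset.sum_le_sum fun j _ => h2 j)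
    _ = ENNReal.ofReal ((1 - c) ^ m + d * s / r * ∑ j ∈ Finset.range m, (1 - c) ^ j) := by
        have h5 : ∀ j, 0 ≤ (d : ℝ) * s / r * (1 - c) ^ j := fun j =>
          mul_nonneg (by positivity) (pow_nonneg (by linarith) j)
        rw [← ENNReal.ofReal_sum_of_nonneg fun j _ => h5 j,
          ← ENNReal.ofReal_add (pow_nonneg (by linarith) m) (Finset.sum_nonneg fun j _ => h5 j),
          Finset.mul_sum]
    _ ≤ _ := by
        refine ENNReal.ofReal_le_ofReal ?_
        have h6 : (d : ℝ) * s / r * ∑ j ∈ Finset.range m, (1 - c) ^ j ≤ d * s / r * (1 / c) :=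
          mul_le_mul_of_nonneg_left hgeom (by positivity)
        calc _ ≤ (s : ℝ) / r + d * s / r * (1 / c) := add_le_add hm h6
          _ = _ := by rw [hc]; field_simp

end

/-! ### The choice of the scales -/

namespace Scales

/-- The conditions on the scales under which the toast is fast to compute. -/
structure IsRapid (P : Scales) (d : ℕ) : Prop where
  r_eq : ∀ k, P.r k = 2 * (P.q + 1) * 16 ^ (k ^ 2)
  rounds : ∀ k, (1 - 1 / (4 * 6 ^ d) : ℝ) ^ P.m k ≤ (P.depth k + k : ℕ) / P.r k

theorem r_pos_of_eq {P : Scales} (hr : ∀ k, P.r k = 2 * (P.q + 1) * 16 ^ (k ^ 2)) (k : ℕ) :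
    0 < P.r k := by rw [hr]; positivity

theorem exists_isRapid (d q : ℕ) : ∃ P : Scales, P.q = q ∧ P.IsRapid d := by
  let r : ℕ → ℕ := fun k => 2 * (q + 1) * 16 ^ (k ^ 2)
  let s : ℕ → ℕ := fun k => (Scales.mk r (fun _ => 0) q).depth k + k
  have hc : (1 - 1 / (4 * 6 ^ d) : ℝ) < 1 := by
    have : (0 : ℝ) < 1 / (4 * 6 ^ d) := by positivity
    linarith
  have hm : ∀ k, ∃ m : ℕ, (1 - 1 / (4 * 6 ^ d) : ℝ) ^ m ≤ (s k : ℕ) / r k := by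
    intro k
    have hs : 0 < s k := by simp only [s, depth, margin]; omega
    have hr : 0 < r k := by simp only [r]; positivity
    obtain ⟨m, hm⟩ := exists_pow_lt_of_lt_one (y := (1 - 1 / (4 * 6 ^ d) : ℝ))
      (x := (s k : ℝ) / r k) (by positivity) hc
    exact ⟨m, hm.le⟩
  choose m hm using hm
  exact ⟨⟨r, m, q⟩, rfl, fun k => rfl, fun k => hm k⟩

namespace IsRapid

variable {P : Scales}

theorem r_pos (hP : P.IsRapid d) (k : ℕ) : 0 < P.r k := r_pos_of_eq hP.r_eq k

theorem r_succ (hP : P.IsRapid d) (k : ℕ) : P.r (k + 1) = 16 ^ (2 * k + 1) * P.r k := by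
  rw [hP.r_eq, hP.r_eq, show (k + 1) ^ 2 = k ^ 2 + (2 * k + 1) by ring, pow_add]
  ring

theorem le_r_succ (hP : P.IsRapid d) (k : ℕ) : 16 * P.r k ≤ P.r (k + 1) := by
  rw [hP.r_succ]
  refine Nat.mul_le_mul_right _ ?_
  calc 16 = 16 ^ 1 := by norm_num
    _ ≤ 16 ^ (2 * k + 1) := Nat.pow_le_pow_right (by norm_num) (by omega)

theorem r_strictMono (hP : P.IsRapid d) : StrictMono P.r := strictMono_nat_of_lt_succ fun k => by
  have := hP.le_r_succ k
  have := hP.r_pos k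
  omega

theorem drift_le (hP : P.IsRapid d) (k : ℕ) : P.drift k ≤ P.r k := by
  induction k with
  | zero => simp [drift]
  | succ k ih => rw [drift_succ]; have := hP.le_r_succ k; omega

/-- The depth is `q + 1 + 3 * drift (k + 1)` with `drift (k + 1) ≤ 2 * r k`, as the drift is
dominated by its last term. Both `q + 1` and `k + 1` are at most `r k / 2`, so `7 * r k` would
already suffice. -/
theorem depth_succ_le (hP : P.IsRapid d) (k : ℕ) : P.depth (k + 1) + (k + 1) ≤ 8 * P.r k := by
  have h1 : 2 * (P.q + 1) ≤ P.r k := by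
    rw [hP.r_eq]
    exact Nat.le_mul_of_pos_right _ (by positivity)
  have h2 : 2 * (k + 1) ≤ P.r k := by
    rw [hP.r_eq]
    have h3 : k + 1 ≤ 16 ^ (k ^ 2) := by
      rcases Nat.eq_zero_or_pos k with rfl | hk
      · simp
      · calc k + 1 ≤ 16 ^ k := Nat.lt_pow_self (by norm_num)
          _ ≤ 16 ^ (k ^ 2) := Nat.pow_le_pow_right (by norm_num) (by nlinarith)
    calc 2 * (k + 1) ≤ 2 * 16 ^ (k ^ 2) := by omega
      _ ≤ 2 * (P.q + 1) * 16 ^ (k ^ 2) := Nat.mul_le_mul_right _ (by omega)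
  have h4 := hP.drift_le k
  have h5 := drift_succ (P := P) k
  unfold depth margin
  omega

theorem two_mul_depth_le (hP : P.IsRapid d) (k : ℕ) : 2 * (P.depth k + k) ≤ P.r k := by
  cases k with
  | zero =>
    have := hP.r_eq 0
    simp [depth, margin, drift]
    omega
  | succ k =>
    have := hP.depth_succ_le k
    have := hP.le_r_succ k
    omega

end IsRapid

end Scales

/-! ### Independent marks out of the labels -/

/-- Both sides are curried forms of one product measure over pairs, reindexed along `Prod.swap`. -/
theorem infinitePi_map_swap {ι κ X : Type*} [MeasurableSpace X] (μ : κ → Measure X)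
    [∀ k, IsProbabilityMeasure (μ k)] :
    (Measure.infinitePi fun _ : ι => Measure.infinitePi μ).map (fun x k i => x i k) =
      Measure.infinitePi fun k => Measure.infinitePi fun _ : ι => μ k := by
  rw [← Measure.infinitePi_map_curry (fun (_ : ι) (k : κ) => μ k),
    ← Measure.infinitePi_map_curry (fun (k : κ) (_ : ι) => μ k),
    Measure.map_map (by fun_prop) (MeasurableEquiv.measurable _)]
  have h := Measure.map_infinitePi_infinitePi_of_inj (P := fun p : ι × κ => μ p.2)
    (f := (Prod.swap : κ × ι → ι × κ)) Prod.swap_injective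
  simp only [Prod.snd_swap] at h
  rw [← h, Measure.map_map (MeasurableEquiv.measurable _) (by fun_prop)]
  rfl

/-- The law of the marks of level `k` at one vertex in one round. -/
noncomputable def markLaw (d r : ℕ) : Measure Bool :=
  ProbabilityTheory.bernoulliMeasure true false ⟨markProb d r, (markProb_pos d r).le, markProb_le_one d r⟩

noncomputable instance (d r : ℕ) : IsProbabilityMeasure (markLaw d r) := by
  unfold markLaw; infer_instance

theorem markLaw_true (d r : ℕ) : markLaw d r {true} = ENNReal.ofReal (markProb d r) := by
  rw [markLaw, ProbabilityTheory.bernoulliMeasure_apply_of_mem_of_notMem _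
    (measurableSet_singleton _) (by simp) (by simp), ENNReal.ofReal]
  congr 1
  ext
  simp [(markProb_pos d r).le]

/-- A measurable way to read off the marks of a vertex from its label. -/
structure MarkReader (d : ℕ) (P : Scales) where
  read : unitInterval → ℕ → ℕ → Bool
  measurable_read : Measurable read
  map_read : (volume : Measure unitInterval).map read =
    Measure.infinitePi fun k => Measure.infinitePi fun _ : ℕ => markLaw d (P.r k)

/-- A uniform variable realises every law on a standard Borel space, so one label supplies
independent marks for all levels and rounds. -/
theorem nonempty_markReader (d : ℕ) (P : Scales) : Nonempty (MarkReader d P) := by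
  obtain ⟨f, hf, hmap⟩ := Measure.exists_measurable_map_eq
    (Measure.infinitePi fun k => Measure.infinitePi fun _ : ℕ => markLaw d (P.r k))
  exact ⟨⟨f, hf, hmap⟩⟩

namespace MarkReader

variable {P : Scales} (f : MarkReader d P)

/-- The marks that are read off from the labels of the vertices. -/
def marks (x : Grid d → unitInterval) : Marks d := fun k j v => f.read (x v) k j

theorem measurable_mark (k j : ℕ) (v : Grid d) : Measurable fun x => f.marks x k j v := by
  have h : Measurable fun x : Grid d → unitInterval => f.read (x v) :=
    f.measurable_read.comp (measurable_pi_apply v)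
  exact (measurable_pi_apply j).comp ((measurable_pi_apply k).comp h)

theorem measurable_marks : Measurable f.marks :=
  measurable_pi_lambda _ fun k => measurable_pi_lambda _ fun j => measurable_pi_lambda _ fun v =>
    f.measurable_mark k j v

/-- The independence is given vertex by vertex; two exchanges of indices make the level the
outermost one, so that events of different levels are visibly independent. -/
theorem map_marks : (iidMeasure d).map f.marks = Measure.infinitePi fun k =>
    Measure.infinitePi fun _ : ℕ => Measure.infinitePi fun _ : Grid d => markLaw d (P.r k) := by
  let S1 : (Grid d → ℕ → ℕ → Bool) → ℕ → Grid d → ℕ → Bool := fun x k v => x v k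
  let S2 : (Grid d → ℕ → Bool) → ℕ → Grid d → Bool := fun x j v => x v j
  have hS1 : Measurable S1 := by fun_prop
  have hS2 : Measurable S2 := by fun_prop
  have hread : Measurable fun (x : Grid d → unitInterval) v => f.read (x v) :=
    measurable_pi_lambda _ fun v => f.measurable_read.comp (measurable_pi_apply v)
  have hlift : Measurable fun (x : ℕ → Grid d → ℕ → Bool) k => S2 (x k) :=
    measurable_pi_lambda _ fun k => hS2.comp (measurable_pi_apply k)
  have hcomp : f.marks = (fun (x : ℕ → Grid d → ℕ → Bool) k => S2 (x k)) ∘ S1 ∘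
      (fun x v => f.read (x v)) := rfl
  rw [hcomp, ← Measure.map_map hlift (hS1.comp hread), ← Measure.map_map hS1 hread, iidMeasure,
    Measure.infinitePi_map_pi (fun _ : Grid d => (volume : Measure unitInterval))
      (fun _ => f.measurable_read)]
  simp only [f.map_read]
  rw [infinitePi_map_swap, Measure.infinitePi_map_pi _ fun _ => hS2]
  simp only [S2, infinitePi_map_swap]

/-- The origin is bad at level `k`. -/
def bad (k : ℕ) : Set (Grid d → unitInterval) :=
  {x | f.marks x k ∈ badSet d (P.r k) (P.m k) (P.depth k + k)}

/-- The origin is bad at all levels up to `k`. -/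
def badUpTo (k : ℕ) : Set (Grid d → unitInterval) := {x | ∀ i ≤ k, x ∈ f.bad i}

theorem measurableSet_badUpTo (k : ℕ) : MeasurableSet (f.badUpTo k) := by
  have h : ∀ i, MeasurableSet (f.bad i) := fun i =>
    have : MeasurableSet ((fun x => f.marks x i) ⁻¹' badSet d (P.r i) (P.m i) (P.depth i + i)) :=
      ((measurable_pi_apply i).comp f.measurable_marks) (measurableSet_badSet _ _ _ _)
    this
  have : f.badUpTo k = ⋂ i ∈ Finset.range (k + 1), f.bad i := by
    ext x; simp [badUpTo]
  rw [this]
  exact Finset.measurableSet_biInter _ fun i _ => h i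

theorem inner_of_notMem_bad (hP : P.IsRapid d) {k : ℕ} {x : Grid d → unitInterval}
    (hx : x ∉ f.bad k) : Inner (P.r k) (P.m k) (f.marks x k) (P.depth k + k) 0 :=
  inner_of_notMem_badSet (by have := hP.two_mul_depth_le k; omega) hx

/-- The constant in the bounds for the probability of being bad. -/
noncomputable def _root_.GridLocal.badConst (d : ℕ) : ℝ := 8 * (1 + 4 * 6 ^ d * d)

theorem _root_.GridLocal.one_le_badConst (d : ℕ) : 1 ≤ badConst d := by
  unfold badConst
  have : (0 : ℝ) ≤ 4 * 6 ^ d * d := by positivity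
  linarith

/-- The required depth is at most `8 * r k`, and `r (k + 1) / r k = 16 ^ (2 * k + 1)`. -/
theorem measure_badSet_succ_le (hP : P.IsRapid d) (k : ℕ) :
    Measure.infinitePi (fun _ : ℕ => Measure.infinitePi fun _ : Grid d => markLaw d (P.r (k + 1)))
      (badSet d (P.r (k + 1)) (P.m (k + 1)) (P.depth (k + 1) + (k + 1))) ≤
      ENNReal.ofReal (badConst d / 16 ^ (2 * k + 1)) := by
  refine (measure_badSet_le (hP.r_pos _) (hP.two_mul_depth_le _) (hP.rounds _)
    (markLaw_true _ _)).trans (ENNReal.ofReal_le_ofReal ?_)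
  have h1 : ((P.depth (k + 1) + (k + 1) : ℕ) : ℝ) ≤ 8 * P.r k := by
    exact_mod_cast hP.depth_succ_le k
  have h2 : (P.r (k + 1) : ℝ) = 16 ^ (2 * k + 1) * P.r k := by exact_mod_cast hP.r_succ k
  have h3 : (0 : ℝ) < P.r k := by exact_mod_cast hP.r_pos k
  rw [h2, badConst, div_le_div_iff₀ (by positivity) (by positivity)]
  calc (1 + 4 * 6 ^ d * (d : ℝ)) * ((P.depth (k + 1) + (k + 1) : ℕ) : ℝ) * 16 ^ (2 * k + 1)
      ≤ (1 + 4 * 6 ^ d * d) * (8 * P.r k) * 16 ^ (2 * k + 1) := by gcongr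
    _ = _ := by ring

theorem measure_bad_succ_le (hP : P.IsRapid d) (k : ℕ) :
    iidMeasure d (f.bad (k + 1)) ≤ ENNReal.ofReal (badConst d / 16 ^ (2 * k + 1)) := by
  refine le_trans (le_of_eq ?_) (measure_badSet_succ_le hP k)
  have h := measurePreserving_eval_infinitePi (fun k => Measure.infinitePi fun _ : ℕ =>
    Measure.infinitePi fun _ : Grid d => markLaw d (P.r k)) (k + 1)
  rw [← h.measure_preimage (measurableSet_badSet _ _ _ _).nullMeasurableSet, ← f.map_marks,
    Measure.map_apply f.measurable_marks (h.measurable (measurableSet_badSet _ _ _ _))]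
  rfl

/-- The levels are independent, so the bounds multiply, and the exponents `1 + 3 + ⋯ + (2 * k - 1)`
add up to `k ^ 2`. -/
theorem measure_badUpTo_le (hP : P.IsRapid d) (k : ℕ) :
    iidMeasure d (f.badUpTo k) ≤ ENNReal.ofReal (badConst d ^ k / 16 ^ (k ^ 2)) := by
  let B : (i : ℕ) → Set (ℕ → Grid d → Bool) := fun i => badSet d (P.r i) (P.m i) (P.depth i + i)
  have hB : ∀ i, MeasurableSet (B i) := fun i => measurableSet_badSet _ _ _ _
  have heq : f.badUpTo k = f.marks ⁻¹' Set.pi (Finset.range (k + 1)) B := by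
    ext x; simp [badUpTo, bad, B, Set.mem_pi]
  rw [heq, ← Measure.map_apply f.measurable_marks
    (MeasurableSet.pi (Finset.countable_toSet _) fun i _ => hB i), f.map_marks,
    Measure.infinitePi_pi _ fun i _ => hB i, Finset.prod_range_succ']
  have hK := one_le_badConst d
  have hprod : ∏ i ∈ Finset.range k, ENNReal.ofReal (badConst d / 16 ^ (2 * i + 1)) =
      ENNReal.ofReal (badConst d ^ k / 16 ^ (k ^ 2)) := by
    rw [← ENNReal.ofReal_prod_of_nonneg fun i _ => by positivity]
    congr 1
    clear heq
    induction k with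
    | zero => simp
    | succ k ih =>
      rw [Finset.prod_range_succ, ih, show (k + 1) ^ 2 = k ^ 2 + (2 * k + 1) by ring,
        pow_add 16 (k ^ 2), pow_succ (badConst d), div_mul_div_comm]
  -- Level `0` has no smaller scale to compare with and contributes the trivial factor `1`.
  calc _ ≤ (∏ i ∈ Finset.range k, ENNReal.ofReal (badConst d / 16 ^ (2 * i + 1))) * 1 :=
        mul_le_mul' (Finset.prod_le_prod' fun i _ => measure_badSet_succ_le hP i) prob_le_one
    _ = _ := by rw [mul_one, hprod]

theorem ae_eventually_notMem_bad (hP : P.IsRapid d) :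
    ∀ᵐ x ∂(iidMeasure d), ∀ᶠ k in atTop, x ∉ f.bad (k + 1) := by
  refine ae_eventually_notMem (ne_top_of_le_ne_top ?_
    (ENNReal.tsum_le_tsum fun k => f.measure_bad_succ_le hP k))
  have hK := one_le_badConst d
  have hs : Summable fun k : ℕ => badConst d / 16 ^ (2 * k + 1) := by
    refine Summable.of_nonneg_of_le (fun k => by positivity) (fun k => ?_)
      ((summable_geometric_of_lt_one (r := (1 / 16 : ℝ)) (by norm_num) (by norm_num)).mul_left
        (badConst d))
    rw [div_eq_mul_inv, one_div, inv_pow]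
    refine mul_le_mul_of_nonneg_left (inv_anti₀ (by positivity) ?_) (by positivity)
    exact pow_le_pow_right₀ (by norm_num) (by omega)
  exact hs.tsum_ofReal_ne_top

/-- By Borel–Cantelli almost all levels are good. The extra `k` in the depth `depth k + k` used for
`bad` then provides arbitrarily large deep neighbourhoods of the origin. -/
theorem ae_isToast (hP : P.IsRapid d) :
    ∀ᵐ x ∂(iidMeasure d), IsToast P.q (P.toast (f.marks x)) := by
  filter_upwards [f.ae_eventually_notMem_bad hP] with x hx
  refine Scales.isToast fun M => ?_
  obtain ⟨k, hk, hMk⟩ := (hx.and (eventually_ge_atTop M)).exists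
  exact ⟨k + 1, (f.inner_of_notMem_bad hP hk).mono (by omega)⟩

end MarkReader

/-! ### Algorithms that work in stages -/

open Classical in
/-- An extension of a labelling of a ball to the whole grid. -/
noncomputable def extendBall {S : Type*} {r : ℕ} (y : Ball d r → S) : Grid d → S := fun u =>
  if h : gridDist u 0 ≤ r then y ⟨u, h⟩ else y ⟨0, by simp [gridDist]⟩

theorem extendBall_view {S : Type*} {r : ℕ} (y : Grid d → S) (v u : Grid d) (hu : gridDist u 0 ≤ r) :
    extendBall (view y v r) u = y (v + u) := by
  simp [extendBall, hu, view]

theorem measurable_extendBall {r : ℕ} :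
    Measurable (extendBall : (Ball d r → unitInterval) → Grid d → unitInterval) := by
  refine measurable_pi_lambda _ fun u => ?_
  by_cases h : gridDist u 0 ≤ r
  · simpa [extendBall, h] using measurable_pi_apply _
  · simpa [extendBall, h] using measurable_pi_apply _

/-- A sequence of attempts to compute the output at the origin, where the attempt at stage `k`
depends on the labels in the ball of radius `ρ k` only. -/
structure Stages (d : ℕ) (Sin Sout : Type*) where
  ρ : ℕ → ℕ
  attempt : ℕ → (Grid d → Sin) → (Grid d → unitInterval) → Option Sout
  strictMono_ρ : StrictMono ρ
  measurable_attempt : ∀ k σ o, MeasurableSet {x | attempt k σ x = some o}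
  attempt_congr : ∀ k σ σ' x x', (∀ u, gridDist u 0 ≤ ρ k → σ u = σ' u) →
    (∀ u, gridDist u 0 ≤ ρ k → x u = x' u) → attempt k σ x = attempt k σ' x'

namespace Stages

variable {Sin Sout : Type*} (F : Stages d Sin Sout)

open Classical in
/-- The algorithm that gives the output of the first successful stage. -/
noncomputable def algorithm : UniformAlgorithm d Sin Sout where
  rule r σ x := if h : ∃ k, F.ρ k = r then F.attempt h.choose (extendBall σ) (extendBall x) else none
  measurable_rule r σ o := by
    by_cases h : ∃ k, F.ρ k = r
    · simp only [h, dif_pos]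
      have : MeasurableSet (extendBall ⁻¹' {x | F.attempt h.choose (extendBall σ) x = some o}) :=
        measurable_extendBall (r := r) (F.measurable_attempt h.choose (extendBall σ) o)
      exact this
    · simp [h]

variable {F} {σ : Grid d → Sin} {x : Grid d → unitInterval} {v : Grid d} {k r : ℕ}

theorem rule_ρ : F.algorithm.rule (F.ρ k) (view σ v (F.ρ k)) (view x v (F.ρ k)) =
    F.attempt k (fun u => σ (v + u)) (fun u => x (v + u)) := by
  have h : ∃ l, F.ρ l = F.ρ k := ⟨k, rfl⟩
  have hk : h.choose = k := F.strictMono_ρ.injective h.choose_spec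
  simp only [algorithm]
  rw [dif_pos h, hk]
  exact F.attempt_congr _ _ _ _ _ (fun u hu => extendBall_view _ _ _ hu)
    (fun u hu => extendBall_view _ _ _ hu)

theorem halts_iff : F.algorithm.Halts σ x v r ↔
    ∃ k, F.ρ k = r ∧ F.attempt k (fun u => σ (v + u)) (fun u => x (v + u)) ≠ none := by
  by_cases h : ∃ k, F.ρ k = r
  · obtain ⟨k, rfl⟩ := h
    rw [UniformAlgorithm.Halts, rule_ρ]
    constructor
    · exact fun h => ⟨k, rfl, h⟩
    · rintro ⟨l, hl, h⟩
      rwa [F.strictMono_ρ.injective hl] at h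
  · constructor
    · intro hh
      exact absurd (by simp [algorithm, h]) hh
    · rintro ⟨k, hk, -⟩
      exact absurd ⟨k, hk⟩ h

theorem exists_output_eq
    (h : ∃ k, F.attempt k (fun u => σ (v + u)) (fun u => x (v + u)) ≠ none) :
    ∃ k o, F.attempt k (fun u => σ (v + u)) (fun u => x (v + u)) = some o ∧
      F.algorithm.output σ x v = some o := by
  classical
  have hex : ∃ r, F.algorithm.Halts σ x v r := by
    obtain ⟨k, hk⟩ := h
    exact ⟨F.ρ k, halts_iff.2 ⟨k, rfl, hk⟩⟩
  obtain ⟨k, hk, hne⟩ := halts_iff.1 (Nat.find_spec hex)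
  obtain ⟨o, ho⟩ := Option.ne_none_iff_exists'.1 hne
  refine ⟨k, o, ho, ?_⟩
  rw [UniformAlgorithm.output, dif_pos hex]
  -- The halting radius equals `ρ k` only propositionally and occurs in the types of the views,
  -- hence the generalisation to `n`.
  have key : ∀ n, F.ρ k = n → F.algorithm.rule n (view σ v n) (view x v n) = some o := by
    rintro n rfl
    rw [rule_ρ, ho]
  convert! key _ hk

theorem radius_le (h : F.attempt k σ x ≠ none) : F.algorithm.radius σ x 0 ≤ F.ρ k := by
  refine iInf₂_le (F.ρ k) (halts_iff.2 ⟨k, rfl, ?_⟩)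
  simpa using h

end Stages

/-! ### Rates -/

theorem exists_pow_div_lt {K ε : ℝ} (hK : 1 ≤ K) (hε : 0 < ε) :
    ∃ k : ℕ, K ^ k / 16 ^ (k ^ 2) < ε := by
  obtain ⟨n, hn⟩ := exists_pow_lt_of_lt_one hε (show (1 / 2 : ℝ) < 1 by norm_num)
  obtain ⟨l, hl⟩ := pow_unbounded_of_one_lt (2 * K) (show (1 : ℝ) < 16 by norm_num)
  refine ⟨n + l, lt_of_le_of_lt ?_ hn⟩
  have h1 : 2 * K ≤ (16 : ℝ) ^ (n + l) :=
    hl.le.trans (pow_le_pow_right₀ (by norm_num) (by omega))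
  calc K ^ (n + l) / 16 ^ ((n + l) ^ 2) = (K / 16 ^ (n + l)) ^ (n + l) := by
        rw [div_pow, ← pow_mul, sq]
    _ ≤ (1 / 2) ^ (n + l) := by
        refine pow_le_pow_left₀ (by positivity) ?_ _
        rw [div_le_div_iff₀ (by positivity) (by norm_num)]
        linarith
    _ ≤ (1 / 2) ^ n := pow_le_pow_of_le_one (by norm_num) (by norm_num) (by omega)

/-- Take the least admissible `k = N ε` and `t ε = c * 16 ^ (N ε ^ 2)`. With `Λ = log₂ (1 / ε)` and
`n = N ε - 1`, minimality gives `4 n² ≤ Λ + κ n`, hence `n ≤ √Λ + κ`. In `log₂ (ε * t ε) = γ + 4 (n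
+ 1)² - Λ` the quadratic term cancels against `Λ`, and what is left is linear in `n`. -/
theorem exists_toastRate {c K : ℝ} (hc : 1 ≤ c) (hK : 1 ≤ K) :
    ∃ t ∈ toastRate, ∀ ε ∈ Set.Ioo (0 : ℝ) 1,
      ∃ k : ℕ, K ^ k / 16 ^ (k ^ 2) < ε ∧ c * 16 ^ (k ^ 2) ≤ t ε := by
  classical
  let N : ℝ → ℕ := fun ε => if h : 0 < ε then Nat.find (exists_pow_div_lt hK h) else 0
  let t : ℝ → ℝ := fun ε => c * 16 ^ (N ε ^ 2)
  have ht : ∀ ε, 0 < t ε := fun ε => by positivity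
  have hN : ∀ ε, 0 < ε → K ^ N ε / 16 ^ (N ε ^ 2) < ε := by
    intro ε hε
    simp only [N, dif_pos hε]
    exact Nat.find_spec (exists_pow_div_lt hK hε)
  have hN' : ∀ ε, 0 < ε → ∀ n, n < N ε → ε ≤ K ^ n / 16 ^ (n ^ 2) := by
    intro ε hε n hn
    simp only [N, dif_pos hε] at hn
    exact not_lt.1 (Nat.find_min _ hn)
  set κ := Real.logb 2 K with hκ
  set γ := Real.logb 2 c with hγ
  have hκ0 : 0 ≤ κ := Real.logb_nonneg (by norm_num) hK
  have hγ0 : 0 ≤ γ := Real.logb_nonneg (by norm_num) hc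
  have h16 : Real.logb 2 16 = 4 := by
    rw [show (16 : ℝ) = 2 ^ (4 : ℝ) by norm_num, Real.logb_rpow] <;> norm_num
  have hlogt : ∀ ε, Real.logb 2 (t ε) = γ + 4 * (N ε : ℝ) ^ 2 := by
    intro ε
    simp only [t]
    rw [Real.logb_mul (by positivity) (by positivity), Real.logb_pow, h16]
    push_cast
    ring
  let g : ℝ → ℝ := fun ε => Real.logb 2 (ε * t ε)
  have hg0 : ∀ ε, 0 < ε → 0 ≤ g ε := by
    intro ε hε
    refine Real.logb_nonneg (by norm_num) ?_
    have h1 := (div_lt_iff₀ (by positivity)).1 (hN ε hε)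
    have h2 : (1 : ℝ) ≤ K ^ N ε := one_le_pow₀ hK
    simp only [t]
    have h3 : 1 ≤ ε * 16 ^ (N ε ^ 2) := by linarith
    calc (1 : ℝ) ≤ ε * 16 ^ (N ε ^ 2) := h3
      _ ≤ c * (ε * 16 ^ (N ε ^ 2)) := le_mul_of_one_le_left (by linarith) hc
      _ = _ := by ring
  have hg1 : ∀ ε ∈ Set.Ioo (0 : ℝ) 1,
      g ε ≤ γ + 4 + (κ + 8) * (√(Real.logb 2 (1 / ε)) + κ) := by
    rintro ε ⟨hε, hε1⟩
    have hg : g ε = Real.logb 2 ε + (γ + 4 * (N ε : ℝ) ^ 2) := by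
      simp only [g]
      rw [Real.logb_mul hε.ne' (ht ε).ne', hlogt]
    set Λ := Real.logb 2 (1 / ε) with hΛ
    have hΛε : Λ = -Real.logb 2 ε := by rw [hΛ, one_div, Real.logb_inv]
    have hΛ0 : 0 ≤ Λ := Real.logb_nonneg (by norm_num) (by rw [le_div_iff₀ hε]; linarith)
    have hsq := Real.sqrt_nonneg Λ
    rcases Nat.eq_zero_or_pos (N ε) with h0 | hpos
    · rw [hg, h0]
      have : 0 ≤ (κ + 8) * (√Λ + κ) := by positivity
      push_cast
      linarith
    · obtain ⟨n, hn⟩ : ∃ n, N ε = n + 1 := ⟨N ε - 1, by omega⟩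
      have h1 := Real.logb_le_logb_of_le (b := 2) (by norm_num) hε (hN' ε hε n (by omega))
      rw [Real.logb_div (by positivity) (by positivity), Real.logb_pow, Real.logb_pow, h16] at h1
      push_cast at h1
      have h2 : (n : ℝ) ≤ √Λ + κ := by
        have h3 : (n : ℝ) ^ 2 ≤ (√Λ + κ) ^ 2 := by
          have h4 := Real.sq_sqrt hΛ0
          have h5 : (0:ℝ) ≤ √Λ * κ := by positivity
          -- The hint absorbs the linear term: `κ * n ≤ n ^ 2 + κ ^ 2 / 4`.
          nlinarith [sq_nonneg ((n : ℝ) - κ / 2)]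
        exact le_of_sq_le_sq h3 (by positivity)
      rw [hg, hn]
      push_cast
      have h6 : (κ + 8) * (n : ℝ) ≤ (κ + 8) * (√Λ + κ) :=
        mul_le_mul_of_nonneg_left h2 (by linarith)
      nlinarith
  refine ⟨t, ⟨g, ?_, ?_⟩, fun ε hε => ⟨N ε, hN ε hε.1, le_rfl⟩⟩
  · refine IsBigO.of_bound (γ + 4 + (κ + 8) * (1 + κ)) ?_
    have hmem : Set.Ioo (0 : ℝ) (1 / 2) ∈ 𝓝[>] (0 : ℝ) := Ioo_mem_nhdsGT (by norm_num)
    filter_upwards [hmem] with ε hε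
    have h1 : ε ∈ Set.Ioo (0 : ℝ) 1 := ⟨hε.1, by linarith [hε.2]⟩
    have hΛ1 : 1 ≤ Real.logb 2 (1 / ε) := by
      rw [Real.le_logb_iff_rpow_le (by norm_num) (by have := hε.1; positivity), Real.rpow_one,
        le_div_iff₀ hε.1]
      linarith [hε.2]
    have hs1 : 1 ≤ √(Real.logb 2 (1 / ε)) := Real.one_le_sqrt.2 hΛ1
    rw [Real.norm_of_nonneg (hg0 ε hε.1), Real.norm_of_nonneg (by positivity)]
    refine (hg1 ε h1).trans ?_
    set s := √(Real.logb 2 (1 / ε))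
    have e1 : γ + 4 ≤ (γ + 4) * s := le_mul_of_one_le_right (by linarith) hs1
    have e2 : (κ + 8) * (s + κ) ≤ (κ + 8) * ((1 + κ) * s) := by
      refine mul_le_mul_of_nonneg_left ?_ (by linarith)
      nlinarith
    nlinarith
  · intro ε hε
    simp only [g]
    rw [Real.rpow_logb (by norm_num) (by norm_num) (mul_pos hε.1 (ht ε))]
    field_simp [hε.1.ne']

/-- Rewriting `2 ^ g` as a power of `1 / ε` divides the exponent by `log₂ (1 / ε)`, and `O(√Λ) / Λ`
tends to `0`. -/
theorem toastRate_subset_nearLinearRate : toastRate ⊆ nearLinearRate := by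
  rintro t ⟨g, hg, ht⟩
  refine ⟨fun ε => g ε / Real.logb 2 (1 / ε), ?_, fun ε hε => ?_⟩
  · have hlog : Tendsto (fun ε : ℝ => Real.logb 2 (1 / ε)) (𝓝[>] 0) atTop := by
      simp only [one_div]
      exact (Real.tendsto_logb_atTop (by norm_num)).comp tendsto_inv_nhdsGT_zero
    obtain ⟨C, hC⟩ := hg.bound
    have hlim : Tendsto (fun ε : ℝ => C / √(Real.logb 2 (1 / ε))) (𝓝[>] 0) (𝓝 0) :=
      Tendsto.const_div_atTop (Real.tendsto_sqrt_atTop.comp hlog) C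
    refine squeeze_zero_norm' ?_ hlim
    filter_upwards [hC, hlog.eventually_ge_atTop 1] with ε h1 h2
    set s := √(Real.logb 2 (1 / ε)) with hs
    have hs1 : 0 < s := Real.sqrt_pos.2 (by linarith)
    have hss : Real.logb 2 (1 / ε) = s * s := (Real.mul_self_sqrt (by linarith)).symm
    rw [Real.norm_of_nonneg hs1.le] at h1
    rw [hss, norm_div, Real.norm_of_nonneg (mul_pos hs1 hs1).le, div_le_div_iff₀ (by positivity) hs1]
    nlinarith
  · have h1 : 1 < 1 / ε := by rw [lt_div_iff₀ hε.1]; linarith [hε.2]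
    have h2 : 0 < Real.logb 2 (1 / ε) := Real.logb_pos (by norm_num) h1
    rw [ht ε hε, Real.rpow_add (by linarith), Real.rpow_one]
    congr 1
    conv_rhs => rw [← Real.rpow_logb (b := 2) (x := 1 / ε) (by norm_num) (by norm_num) (by linarith)]
    rw [← Real.rpow_mul (by norm_num), mul_div_cancel₀ _ h2.ne']

theorem LCL.InULocal.mono {Sin Sout : Type*} {L : LCL d Sin Sout} {T T' : Set (ℝ → ℝ)}
    (h : L.InULocal T) (hT : T ⊆ T') : L.InULocal T' := by
  obtain ⟨t, ht, A⟩ := h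
  exact ⟨t, hT ht, A⟩

/-! ### Algorithms whose coding radius has a fast decay -/

/-- The coding radius at the origin is at most `c * 16 ^ k ^ 2` outside of an event that does not
depend on the input and whose probability is at most `K ^ k / 16 ^ k ^ 2`. -/
def UniformAlgorithm.IsFast {Sin Sout : Type*} (A : UniformAlgorithm d Sin Sout) (c : ℕ) (K : ℝ) : Prop :=
  ∃ S : ℕ → Set (Grid d → unitInterval), ∀ k, MeasurableSet (S k) ∧
    iidMeasure d (S k) ≤ ENNReal.ofReal (K ^ k / 16 ^ (k ^ 2)) ∧
    ∀ σ, ∀ x ∉ S k, A.radius σ x 0 ≤ (c * 16 ^ (k ^ 2) : ℕ)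

theorem UniformAlgorithm.IsFast.hasComplexity {Sin Sout : Type*} {A : UniformAlgorithm d Sin Sout}
    {c : ℕ} {K : ℝ} (hA : A.IsFast c K) {t : ℝ → ℝ} (ht : ∀ ε ∈ Set.Ioo (0 : ℝ) 1,
      ∃ k : ℕ, K ^ k / 16 ^ (k ^ 2) < ε ∧ c * 16 ^ (k ^ 2) ≤ t ε) : A.HasComplexity t := by
  obtain ⟨S, hS⟩ := hA
  intro ε hε
  obtain ⟨k, hk, hkt⟩ := ht ε hε
  obtain ⟨-, hmeas, hrad⟩ := hS k
  refine lt_of_le_of_lt (iSup_le fun σ => (measure_mono fun x hx => ?_).trans hmeas)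
    ((ENNReal.ofReal_lt_ofReal_iff hε.1).2 hk)
  by_contra hxS
  have h1 : ((A.radius σ x 0 : ℝ≥0∞) : EReal) ≤ (((c * 16 ^ (k ^ 2) : ℕ) : ℝ≥0∞) : EReal) := by
    have h2 := ENat.toENNReal_le.2 (hrad σ x hxS)
    rw [ENat.toENNReal_coe] at h2
    exact EReal.coe_ennreal_le_coe_ennreal_iff.2 h2
  have h3 : ∀ n : ℕ, ((n : ℝ≥0∞) : EReal) = ((n : ℝ) : EReal) := fun n => by
    rw [← ENNReal.ofReal_natCast, EReal.coe_ennreal_ofReal, max_eq_left (Nat.cast_nonneg _)]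
  rw [h3] at h1
  have h4 : (((c * 16 ^ (k ^ 2) : ℕ) : ℝ) : EReal) ≤ ((t ε : ℝ) : EReal) := by
    rw [EReal.coe_le_coe_iff]
    push_cast
    exact hkt
  exact absurd (lt_of_lt_of_le hx (h1.trans h4)) (lt_irrefl _)

/-- Root test: the base `B * θ ^ k` is eventually at most `1 / 2`. -/
theorem summable_of_quadratic_decay {B θ : ℝ} (hB : 0 ≤ B) (hθ : 0 ≤ θ) (hθ1 : θ < 1) :
    Summable fun k : ℕ => (B * θ ^ k) ^ k := by
  have hlim : Tendsto (fun k : ℕ => B * θ ^ k) atTop (𝓝 0) := by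
    simpa using (tendsto_pow_atTop_nhds_zero_of_lt_one hθ hθ1).const_mul B
  refine summable_of_isBigO_nat (summable_geometric_of_lt_one (r := (1 / 2 : ℝ)) (by norm_num)
    (by norm_num)) (IsBigO.of_bound 1 ?_)
  filter_upwards [hlim.eventually_le_const (show (0 : ℝ) < 1 / 2 by norm_num)] with k hk
  rw [Real.norm_of_nonneg (by positivity), Real.norm_of_nonneg (by positivity), one_mul]
  exact pow_le_pow_left₀ (by positivity) hk k

/-- If `k + 1` is the least index whose bad event fails, then `S k` occurs and the radius is at most
`c * 16 ^ ((k + 1) ^ 2)`. With `b = 16 ^ α < 16`, the factor `(b / 16) ^ (k ^ 2)` beats the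
exponential factors `b ^ (2 * k)` and `K ^ k`. -/
theorem UniformAlgorithm.IsFast.hasFiniteMoment {Sin Sout : Type*} {A : UniformAlgorithm d Sin Sout}
    {c : ℕ} {K : ℝ} (hA : A.IsFast c K) (hc : 0 < c) (hK : 0 ≤ K) {α : ℝ≥0} (hα : α < 1) :
    A.HasFiniteMoment α := by
  obtain ⟨S, hS⟩ := hA
  let ρ : ℕ → ℝ≥0∞ := fun k => ((c * 16 ^ (k ^ 2) : ℕ) : ℝ≥0∞) ^ (α : ℝ)
  have hρ1 : ∀ k, 1 ≤ ρ k := by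
    intro k
    have h1 : (1 : ℝ≥0∞) ≤ ((c * 16 ^ (k ^ 2) : ℕ) : ℝ≥0∞) := by
      exact_mod_cast Nat.one_le_iff_ne_zero.2 (by positivity)
    simpa [ρ] using ENNReal.rpow_le_rpow h1 α.coe_nonneg
  have hbound : ∀ σ x, (A.radius σ x 0 : ℝ≥0∞) ^ (α : ℝ) ≤
      ρ 0 + ∑' k, (S k).indicator (fun _ => ρ (k + 1)) x := by
    intro σ x
    have hle : ∀ k, x ∉ S k → (A.radius σ x 0 : ℝ≥0∞) ^ (α : ℝ) ≤ ρ k := by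
      intro k hk
      have h2 := ENat.toENNReal_le.2 ((hS k).2.2 σ x hk)
      rw [ENat.toENNReal_coe] at h2
      exact ENNReal.rpow_le_rpow h2 α.2
    classical
    by_cases hex : ∃ k, x ∉ S k
    · rcases Nat.eq_zero_or_pos (Nat.find hex) with h0 | hpos
      · have := hle _ (Nat.find_spec hex)
        rw [h0] at this
        exact this.trans le_self_add
      · obtain ⟨n, hn⟩ : ∃ n, Nat.find hex = n + 1 := ⟨Nat.find hex - 1, by omega⟩
        have h1 := hle _ (Nat.find_spec hex)
        rw [hn] at h1
        have h2 : x ∈ S n := by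
          by_contra h
          exact Nat.find_min hex (by omega : n < Nat.find hex) h
        calc _ ≤ ρ (n + 1) := h1
          _ = (S n).indicator (fun _ => ρ (n + 1)) x := by simp [h2]
          _ ≤ ∑' k, (S k).indicator (fun _ => ρ (k + 1)) x :=
            ENNReal.le_tsum (f := fun k => (S k).indicator (fun _ => ρ (k + 1)) x) n
          _ ≤ _ := le_add_self
    -- On this event the radius may be infinite, but all terms of the series are at least `1`, so
    -- the bound is `⊤`.
    · have hall : ∀ k, x ∈ S k := by simpa using hex
      have : ∑' k, (S k).indicator (fun _ => ρ (k + 1)) x = ⊤ := by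
        refine top_unique ?_
        rw [← ENNReal.tsum_const_eq_top_of_ne_zero (α := ℕ) (one_ne_zero (α := ℝ≥0∞))]
        refine ENNReal.tsum_le_tsum fun k => ?_
        simpa [hall k] using hρ1 (k + 1)
      rw [this]
      simp
  have hint : ∀ σ, ∫⁻ x, (A.radius σ x 0 : ℝ≥0∞) ^ (α : ℝ) ∂(iidMeasure d) ≤
      ρ 0 + ∑' k, ρ (k + 1) * ENNReal.ofReal (K ^ k / 16 ^ (k ^ 2)) := by
    intro σ
    have : IsProbabilityMeasure (iidMeasure d) := by unfold iidMeasure; infer_instance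
    calc _ ≤ ∫⁻ x, ρ 0 + ∑' k, (S k).indicator (fun _ => ρ (k + 1)) x ∂(iidMeasure d) :=
          lintegral_mono (hbound σ)
      _ = ρ 0 + ∑' k, ∫⁻ x, (S k).indicator (fun _ => ρ (k + 1)) x ∂(iidMeasure d) := by
          rw [lintegral_add_left measurable_const, lintegral_const, measure_univ, mul_one,
            lintegral_tsum fun k => (measurable_const.indicator (hS k).1).aemeasurable]
      _ ≤ _ := by
          refine add_le_add le_rfl (ENNReal.tsum_le_tsum fun k => ?_)
          rw [lintegral_indicator_const (hS k).1]
          exact mul_le_mul_right (hS k).2.1 _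
  refine lt_of_le_of_lt (iSup_le hint) ?_
  have hρr : ∀ k, ρ k = ENNReal.ofReal ((c * 16 ^ (k ^ 2) : ℝ) ^ (α : ℝ)) := by
    intro k
    simp only [ρ]
    rw [← ENNReal.ofReal_rpow_of_nonneg (by positivity) α.coe_nonneg]
    congr 1
    rw [← ENNReal.ofReal_natCast]
    push_cast
    rfl
  refine ENNReal.add_lt_top.2 ⟨by rw [hρr]; exact ENNReal.ofReal_lt_top, ?_⟩
  set b : ℝ := (16 : ℝ) ^ (α : ℝ) with hb
  have hb0 : 0 < b := by positivity
  have hb16 : b < 16 := by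
    calc b < (16 : ℝ) ^ (1 : ℝ) := Real.rpow_lt_rpow_of_exponent_lt (by norm_num) (by exact_mod_cast hα)
      _ = 16 := Real.rpow_one 16
  have hsum : Summable fun k : ℕ => (c : ℝ) ^ (α : ℝ) * b * (b ^ 2 * K * (b / 16) ^ k) ^ k :=
    (summable_of_quadratic_decay (by positivity) (by positivity)
      ((div_lt_one (by norm_num)).2 hb16)).mul_left _
  have hterm : ∀ k, ρ (k + 1) * ENNReal.ofReal (K ^ k / 16 ^ (k ^ 2)) =
      ENNReal.ofReal ((c : ℝ) ^ (α : ℝ) * b * (b ^ 2 * K * (b / 16) ^ k) ^ k) := by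
    intro k
    rw [hρr, ← ENNReal.ofReal_mul (by positivity)]
    congr 1
    rw [Real.mul_rpow (by positivity) (by positivity), ← Real.rpow_natCast, ← Real.rpow_mul (by norm_num),
      mul_comm (((k + 1) ^ 2 : ℕ) : ℝ), Real.rpow_mul (by norm_num), ← hb, Real.rpow_natCast]
    have : b ^ ((k + 1) ^ 2) = b ^ (k ^ 2) * (b ^ 2) ^ k * b := by
      rw [← pow_mul, ← pow_add, ← pow_succ]; congr 1; ring
    rw [this, mul_pow, mul_pow, div_pow, div_pow, ← pow_mul, ← pow_mul, ← pow_mul, ← sq]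
    ring
  simp only [hterm]
  exact hsum.tsum_ofReal_lt_top

theorem LCL.one_le_momentExponent {Sin Sout : Type*} {L : LCL d Sin Sout}
    {A : UniformAlgorithm d Sin Sout} (hL : A.Solves L) {c : ℕ} {K : ℝ} (hA : A.IsFast c K)
    (hc : 0 < c) (hK : 0 ≤ K) : 1 ≤ L.momentExponent := by
  refine le_of_forall_lt_imp_le_of_dense fun a ha => ?_
  lift a to ℝ≥0 using ne_top_of_lt ha
  exact le_iSup₂ (f := fun (α : ℝ≥0) (_ : ∃ A : UniformAlgorithm d Sin Sout,
    A.Solves L ∧ A.HasFiniteMoment α) => (α : ℝ≥0∞)) a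
    ⟨A, hL, hA.hasFiniteMoment hc hK (by exact_mod_cast ha)⟩

/-! ### Running a toast algorithm -/

open Classical in
/-- Some value with the property `p`, if there is one. -/
noncomputable def pick {S : Type*} (p : S → Prop) : Option S :=
  if h : ∃ o, p o then some h.choose else none

theorem pick_spec {S : Type*} {p : S → Prop} (h : ∃ o, p o) : ∃ o, pick p = some o ∧ p o :=
  ⟨h.choose, by rw [pick, dif_pos h], h.choose_spec⟩

theorem exists_of_pick_ne_none {S : Type*} {p : S → Prop} (h : pick p ≠ none) : ∃ o, p o := by
  by_contra hc
  exact h (by rw [pick, dif_neg hc])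

namespace ToastAlgorithm

variable {Sin Sout : Type*} (A : ToastAlgorithm d Sin Sout)

/-- The union of the colourings of the pieces strictly inside `D`. -/
noncomputable def innerColoring (𝒟 : Set (Finset (Grid d))) (σ : Grid d → Sin)
    (D : Finset (Grid d)) : Grid d → Option Sout :=
  fun v => pick fun o => ∃ E, ∃ _ : E ⊂ D, E ∈ 𝒟 ∧ A.colorPiece 𝒟 σ E v = some o

theorem colorPiece_eq (𝒟 : Set (Finset (Grid d))) (σ : Grid d → Sin) (D : Finset (Grid d)) :
    A.colorPiece 𝒟 σ D = A.rule D σ (A.innerColoring 𝒟 σ D) := by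
  rw [colorPiece]
  rfl

theorem colorGrid_eq (𝒟 : Set (Finset (Grid d))) (σ : Grid d → Sin) (v : Grid d) :
    A.colorGrid 𝒟 σ v = pick fun o => ∃ D ∈ 𝒟, A.colorPiece 𝒟 σ D v = some o := rfl

variable {A} {𝒟 𝒟' : Set (Finset (Grid d))} {σ σ' : Grid d → Sin} {D : Finset (Grid d)} {v : Grid d}

theorem supportedOn_innerColoring (h𝒟 : ∀ E ∈ 𝒟, IsPiece E)
    (h : ∀ E, E ⊂ D → IsPiece E → SupportedOn (A.colorPiece 𝒟 σ E) E) :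
    SupportedOn (A.innerColoring 𝒟 σ D) D := by
  intro v hv
  obtain ⟨o, E, hE, hE𝒟, ho⟩ := exists_of_pick_ne_none hv
  exact hE.1 (h E hE (h𝒟 E hE𝒟) v (by simp [ho]))

theorem supportedOn_colorPiece (h𝒟 : ∀ E ∈ 𝒟, IsPiece E) (hD : IsPiece D) :
    SupportedOn (A.colorPiece 𝒟 σ D) D := by
  induction D using Finset.strongInduction with
  | H D ih =>
    rw [colorPiece_eq]
    exact A.supported D σ _ hD (supportedOn_innerColoring h𝒟 ih)

theorem supportedOn_innerColoring' (h𝒟 : ∀ E ∈ 𝒟, IsPiece E) :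
    SupportedOn (A.innerColoring 𝒟 σ D) D :=
  supportedOn_innerColoring h𝒟 fun _ _ hE => supportedOn_colorPiece h𝒟 hE

theorem IsSpontaneous.colorPiece_ne_none (hA : A.IsSpontaneous) (h𝒟 : ∀ E ∈ 𝒟, IsPiece E)
    (hD : IsPiece D) (hv : v ∈ D) : A.colorPiece 𝒟 σ D v ≠ none := by
  rw [colorPiece_eq]
  exact hA D σ _ hD (supportedOn_innerColoring' h𝒟) v hv

theorem shiftSet_ssubset {g : Grid d} {E D : Finset (Grid d)} :
    shiftSet g E ⊂ shiftSet g D ↔ E ⊂ D := Finset.map_ssubset_map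

/-- The colouring of a piece depends only on the pieces and the labels inside of it, up to
translation. -/
theorem colorPiece_shift (g : Grid d) (h𝒟' : ∀ E ∈ 𝒟', IsPiece E) (hD : IsPiece D)
    (h : ∀ E ⊆ D, E ∈ 𝒟' ↔ shiftSet g E ∈ 𝒟) (hσ : ∀ v ∈ D, σ (v + g) = σ' v) (v : Grid d) :
    A.colorPiece 𝒟 σ (shiftSet g D) (v + g) = A.colorPiece 𝒟' σ' D v := by
  induction D using Finset.strongInduction generalizing v with
  | H D ih =>
    rw [colorPiece_eq, colorPiece_eq]
    refine A.equivariant D σ' _ hD (supportedOn_innerColoring' h𝒟') g σ _ hσ (fun w => ?_) v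
    refine congrArg pick (funext fun o => propext ⟨?_, ?_⟩)
    · rintro ⟨E, hE, hE𝒟, ho⟩
      rw [← shiftSet_shiftSet_neg g E] at hE hE𝒟 ho
      have hE' := shiftSet_ssubset.1 hE
      have hmem := (h _ hE'.1).2 hE𝒟
      refine ⟨_, hE', hmem, ?_⟩
      rw [← ho]
      exact (ih _ hE' (h𝒟' _ hmem) (fun F hF => h F (hF.trans hE'.1))
        (fun u hu => hσ u (hE'.1 hu)) w).symm
    · rintro ⟨E, hE, hE𝒟, ho⟩
      refine ⟨shiftSet g E, shiftSet_ssubset.2 hE, (h E hE.1).1 hE𝒟, ?_⟩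
      rw [← ho]
      exact ih E hE (h𝒟' E hE𝒟) (fun F hF => h F (hF.trans hE.1)) (fun u hu => hσ u (hE.1 hu)) w

theorem colorPiece_congr (h𝒟' : ∀ E ∈ 𝒟', IsPiece E) (hD : IsPiece D)
    (h : ∀ E ⊆ D, E ∈ 𝒟' ↔ E ∈ 𝒟) (hσ : ∀ v ∈ D, σ v = σ' v) (v : Grid d) :
    A.colorPiece 𝒟 σ D v = A.colorPiece 𝒟' σ' D v := by
  have := colorPiece_shift (A := A) (𝒟 := 𝒟) (σ := σ) (σ' := σ') 0 h𝒟' hD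
    (fun E hE => by rw [shiftSet_zero]; exact h E hE) (fun v hv => by rw [add_zero]; exact hσ v hv) v
  rwa [shiftSet_zero, add_zero] at this

/-- Whichever smaller piece `E` the choice in `pick` selects, it contains `v`, and by induction its
colour at `v` is that of `D₀`; the rule at `D` then extends it. This is where the choice is seen to
be immaterial. -/
theorem IsSpontaneous.colorPiece_eq_of_isLeast (hA : A.IsSpontaneous) (h𝒟 : ∀ E ∈ 𝒟, IsPiece E)
    {D₀ : Finset (Grid d)} (hD₀ : IsLeast {E | E ∈ 𝒟 ∧ v ∈ E} D₀) (hD : D ∈ 𝒟) (hv : v ∈ D) :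
    A.colorPiece 𝒟 σ D v = A.colorPiece 𝒟 σ D₀ v := by
  induction D using Finset.strongInduction with
  | H D ih =>
    rcases (hD₀.2 ⟨hD, hv⟩ : D₀ ⊆ D).eq_or_ssubset with rfl | hlt
    · rfl
    obtain ⟨o₀, ho₀⟩ := Option.ne_none_iff_exists'.1
      (hA.colorPiece_ne_none (σ := σ) h𝒟 (h𝒟 _ hD₀.1.1) hD₀.1.2)
    obtain ⟨o, ho, E, hE, hE𝒟, hEo⟩ := pick_spec
      (p := fun o => ∃ E, ∃ _ : E ⊂ D, E ∈ 𝒟 ∧ A.colorPiece 𝒟 σ E v = some o)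
      ⟨o₀, D₀, hlt, hD₀.1.1, ho₀⟩
    have hvE : v ∈ E := supportedOn_colorPiece (A := A) (σ := σ) h𝒟 (h𝒟 E hE𝒟) v (by simp [hEo])
    rw [← ih E hE hE𝒟 hvE, hEo, colorPiece_eq]
    exact A.extending D σ _ (h𝒟 D hD) (supportedOn_innerColoring' h𝒟) v o ho

theorem IsSpontaneous.colorGrid_eq_of_isLeast (hA : A.IsSpontaneous) (h𝒟 : ∀ E ∈ 𝒟, IsPiece E)
    {D₀ : Finset (Grid d)} (hD₀ : IsLeast {E | E ∈ 𝒟 ∧ v ∈ E} D₀) :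
    A.colorGrid 𝒟 σ v = A.colorPiece 𝒟 σ D₀ v := by
  obtain ⟨o₀, ho₀⟩ := Option.ne_none_iff_exists'.1
    (hA.colorPiece_ne_none (σ := σ) h𝒟 (h𝒟 _ hD₀.1.1) hD₀.1.2)
  obtain ⟨o, ho, E, hE𝒟, hEo⟩ := pick_spec
    (p := fun o => ∃ D ∈ 𝒟, A.colorPiece 𝒟 σ D v = some o) ⟨o₀, D₀, hD₀.1.1, ho₀⟩
  have hvE : v ∈ E := supportedOn_colorPiece (A := A) (σ := σ) h𝒟 (h𝒟 E hE𝒟) v (by simp [hEo])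
  rw [colorGrid_eq, ho, ← hEo, hA.colorPiece_eq_of_isLeast h𝒟 hD₀ hE𝒟 hvE]

end ToastAlgorithm

/-! ### The least piece containing a vertex -/

namespace Scales

variable {P : Scales} {χ : Marks d} {k : ℕ} {v : Grid d} {D E : Finset (Grid d)}

theorem isPiece_of_mem_levelsUpTo (hD : D ∈ P.levelsUpTo χ k) : IsPiece D := by
  obtain ⟨l, -, hD⟩ := hD
  exact isPiece_of_mem_level hD

theorem nonempty_of_mem_level (hD : D ∈ P.level χ k) : D.Nonempty := by
  obtain ⟨z, -, hDz⟩ := hD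
  exact ⟨z, Finset.mem_coe.1 (hDz ▸ self_mem_component)⟩

/-- Pieces that share a vertex are comparable, so a minimal one is least. -/
theorem exists_isLeast (hD : D ∈ P.levelsUpTo χ k) (hv : v ∈ D) :
    ∃ D, IsLeast {E | E ∈ P.levelsUpTo χ k ∧ v ∈ E} D := by
  obtain ⟨D₀, hD₀, hmin⟩ := (wellFounded_lt (α := Finset (Grid d))).has_min
    {E | E ∈ P.levelsUpTo χ k ∧ v ∈ E} ⟨D, hD, hv⟩
  refine ⟨D₀, hD₀, fun E hE => ?_⟩
  obtain ⟨⟨l, -, h1⟩, h1v⟩ := hD₀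
  obtain ⟨⟨l', -, h2⟩, h2v⟩ := id hE
  rcases lt_trichotomy l l' with hl | rfl | hl
  · exact subset_of_level_lt hl h1 h2 h1v h2v
  · exact (eq_of_level_eq_of_near h1 h2 h1v h2v (Near.refl _ _)).le
  · have h3 := subset_of_level_lt hl h2 h1 h2v h1v
    by_contra h4
    exact hmin E hE (lt_of_le_not_ge h3 h4)

/-- Pieces of higher levels through `v` contain `D`, so later levels never revise the answer. -/
theorem isLeast_toast (h : IsLeast {E | E ∈ P.levelsUpTo χ k ∧ v ∈ E} D) :
    IsLeast {E | E ∈ P.toast χ ∧ v ∈ E} D := by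
  obtain ⟨⟨⟨l, hl, hD⟩, hv⟩, hmin⟩ := h
  refine ⟨⟨⟨l, hD⟩, hv⟩, ?_⟩
  rintro E ⟨⟨l', hE⟩, hvE⟩
  by_cases hl' : l' ≤ k
  · exact hmin ⟨⟨l', hl', hE⟩, hvE⟩
  · exact subset_of_level_lt (by omega) hD hE hv hvE

/-- A piece of a higher level inside `D` also contains `D`, so it equals `D`. The inner structure of
`D` is thus complete at level `k`. -/
theorem mem_levelsUpTo_of_subset (hD : D ∈ P.levelsUpTo χ k) (hE : E ∈ P.toast χ) (hED : E ⊆ D) :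
    E ∈ P.levelsUpTo χ k := by
  obtain ⟨l, hl, hD⟩ := hD
  obtain ⟨l', hE⟩ := hE
  by_cases hl' : l' ≤ k
  · exact ⟨l', hl', hE⟩
  obtain ⟨x, hx⟩ := nonempty_of_mem_level hE
  have := subset_of_level_lt (by omega) hD hE (hED hx) hx
  exact ⟨l, hl, hED.antisymm this ▸ hD⟩

theorem IsRapid.near_of_mem_levelsUpTo (hP : P.IsRapid d) (hD : D ∈ P.levelsUpTo χ k)
    (h0 : (0 : Grid d) ∈ D) (hv : v ∈ D) : Near (6 * P.r k) 0 v := by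
  obtain ⟨l, hl, hD⟩ := hD
  have h1 := hP.drift_le l
  have h2 := hP.r_strictMono.monotone hl
  exact (near_of_mem_level hD h0 hv).mono (by omega)

/-- A piece through the origin reaches at most `6 * r k`; checking it takes `1` for outer
neighbours, at most `r k` for the drift and `5 * r k` for the cells, well below `20 * r k`. -/
theorem IsRapid.mem_levelsUpTo_congr (hP : P.IsRapid d) {χ χ' : Marks d}
    (h : ∀ l ≤ k, ∀ j < P.m l, ∀ w, Near (20 * P.r k) 0 w → χ l j w = χ' l j w)
    (hD : ∀ v ∈ D, Near (6 * P.r k) 0 v) : D ∈ P.levelsUpTo χ k ↔ D ∈ P.levelsUpTo χ' k := by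
  have hN : ∀ l ≤ k, 6 * P.r k + 1 + P.drift l + 5 * P.r l ≤ 20 * P.r k := by
    intro l hl
    have h1 := hP.drift_le l
    have h2 := hP.r_strictMono.monotone hl
    have h3 := hP.r_pos k
    omega
  exact ⟨fun ⟨l, hl, hm⟩ => ⟨l, hl, mem_level_of_agree hN h hD hl hm⟩,
    fun ⟨l, hl, hm⟩ => ⟨l, hl, mem_level_of_agree hN
      (fun l hl j hj w hw => (h l hl j hj w hw).symm) hD hl hm⟩⟩

end Scales

/-! ### Algorithms that answer in terms of the least piece -/

/-- An answer that is computed from the least piece containing the origin, the pieces inside of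
it, and the labels on it. -/
structure PieceAnswer (d : ℕ) (Sin Sout : Type*) where
  ans : Set (Finset (Grid d)) → (Grid d → Sin) → Finset (Grid d) → Option Sout
  ans_ne_none : ∀ 𝒟 σ D, (∀ E ∈ 𝒟, IsPiece E) → D ∈ 𝒟 → 0 ∈ D → ans 𝒟 σ D ≠ none
  ans_congr : ∀ 𝒟 𝒟' σ σ' D, (∀ E ∈ 𝒟, IsPiece E) → (∀ E ∈ 𝒟', IsPiece E) → D ∈ 𝒟 →
    (∀ E ⊆ D, E ∈ 𝒟 ↔ E ∈ 𝒟') → (∀ v ∈ D, σ v = σ' v) → ans 𝒟 σ D = ans 𝒟' σ' D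

namespace PieceAnswer

variable {Sin Sout : Type*} (G : PieceAnswer d Sin Sout) {P : Scales}

open Classical in
/-- The answer at the origin when only the levels up to `k` are taken into account. -/
noncomputable def stage (P : Scales) (χ : Marks d) (k : ℕ) (σ : Grid d → Sin) : Option Sout :=
  if h : ∃ D, IsLeast {E | E ∈ P.levelsUpTo χ k ∧ 0 ∈ E} D then
    G.ans (P.levelsUpTo χ k) σ h.choose else none

variable {G} {χ : Marks d} {k : ℕ} {σ : Grid d → Sin} {D : Finset (Grid d)}

theorem stage_eq (h : IsLeast {E | E ∈ P.levelsUpTo χ k ∧ 0 ∈ E} D) :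
    G.stage P χ k σ = G.ans (P.levelsUpTo χ k) σ D := by
  have hex : ∃ D, IsLeast {E | E ∈ P.levelsUpTo χ k ∧ 0 ∈ E} D := ⟨D, h⟩
  rw [stage, dif_pos hex, hex.choose_spec.unique h]

theorem stage_ne_none (hD : D ∈ P.levelsUpTo χ k) (h0 : 0 ∈ D) : G.stage P χ k σ ≠ none := by
  obtain ⟨D₀, hD₀⟩ := Scales.exists_isLeast hD h0
  rw [stage_eq hD₀]
  exact G.ans_ne_none _ _ _ (fun E hE => Scales.isPiece_of_mem_levelsUpTo hE) hD₀.1.1 hD₀.1.2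

theorem stage_congr (hP : P.IsRapid d) {χ χ' : Marks d} {σ σ' : Grid d → Sin}
    (h : ∀ l ≤ k, ∀ j < P.m l, ∀ w, Near (20 * P.r k) 0 w → χ l j w = χ' l j w)
    (hσ : ∀ w, Near (20 * P.r k) 0 w → σ w = σ' w) : G.stage P χ k σ = G.stage P χ' k σ' := by
  have hset : {E | E ∈ P.levelsUpTo χ k ∧ 0 ∈ E} = {E | E ∈ P.levelsUpTo χ' k ∧ 0 ∈ E} := by
    ext E
    constructor
    · rintro ⟨hE, h0⟩
      exact ⟨(hP.mem_levelsUpTo_congr h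
        fun v hv => hP.near_of_mem_levelsUpTo hE h0 hv).1 hE, h0⟩
    · rintro ⟨hE, h0⟩
      exact ⟨(hP.mem_levelsUpTo_congr h
        fun v hv => hP.near_of_mem_levelsUpTo hE h0 hv).2 hE, h0⟩
  by_cases hex : ∃ D, IsLeast {E | E ∈ P.levelsUpTo χ k ∧ 0 ∈ E} D
  · obtain ⟨D, hD⟩ := hex
    have hnear := fun v (hv : v ∈ D) => hP.near_of_mem_levelsUpTo hD.1.1 hD.1.2 hv
    rw [stage_eq hD, stage_eq (hset ▸ hD)]
    refine G.ans_congr _ _ _ _ _ (fun E hE => Scales.isPiece_of_mem_levelsUpTo hE)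
      (fun E hE => Scales.isPiece_of_mem_levelsUpTo hE) hD.1.1
      (fun E hE => hP.mem_levelsUpTo_congr h fun v hv => hnear v (hE hv))
      (fun v hv => hσ v ((hnear v hv).mono (by omega)))
  · rw [stage, dif_neg hex, stage, dif_neg (hset ▸ hex)]

/-- The stage factors through the finitely many Boolean marks in a bounded window, and every subset
of that finite space is measurable. -/
theorem measurable_stage (hP : P.IsRapid d) (f : MarkReader d P) (k : ℕ) (σ : Grid d → Sin) (o : Sout) :
    MeasurableSet {x | G.stage P (f.marks x) k σ = some o} := by
  classical
  let T : Finset (ℕ × ℕ × Grid d) :=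
    Finset.range (k + 1) ×ˢ Finset.range ((Finset.range (k + 1)).sup P.m) ×ˢ box d (20 * P.r k)
  let R : (Grid d → unitInterval) → T → Bool := fun x t => f.marks x t.1.1 t.1.2.1 t.1.2.2
  have hR : Measurable R := measurable_pi_lambda _ fun t => f.measurable_mark _ _ _
  have key : ∀ x x', R x = R x' → G.stage P (f.marks x) k σ = G.stage P (f.marks x') k σ := by
    intro x x' hxx
    refine stage_congr hP (fun l hl j hj w hw => ?_) fun _ _ => rfl
    have hl' : l ∈ Finset.range (k + 1) := Finset.mem_range.2 (by omega)
    have hmem : (l, j, w) ∈ T := Finset.mem_product.2 ⟨hl', Finset.mem_product.2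
      ⟨Finset.mem_range.2 (hj.trans_le (Finset.le_sup (f := P.m) hl')), mem_box.2 hw⟩⟩
    exact congrFun hxx ⟨(l, j, w), hmem⟩
  have : {x | G.stage P (f.marks x) k σ = some o} =
      R ⁻¹' (R '' {x | G.stage P (f.marks x) k σ = some o}) := by
    refine (Set.subset_preimage_image _ _).antisymm ?_
    rintro x ⟨x', hx', hxx⟩
    exact (key x' x hxx).symm.trans hx'
  rw [this]
  exact hR (Set.toFinite _).measurableSet

variable (G) in
/-- The stages of the computation of the answer. -/
noncomputable def stages (hd : 1 ≤ d) (hP : P.IsRapid d) (f : MarkReader d P) : Stages d Sin Sout where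
  ρ k := d * (20 * P.r k)
  attempt k σ x := G.stage P (f.marks x) k σ
  strictMono_ρ := fun k l hkl => Nat.mul_lt_mul_of_pos_left
    (Nat.mul_lt_mul_of_pos_left (hP.r_strictMono hkl) (by norm_num)) hd
  measurable_attempt k σ o := measurable_stage hP f k σ o
  attempt_congr k σ σ' x x' hσ hx := by
    refine stage_congr hP (fun l _ j _ w hw => ?_) fun w hw => hσ w (gridDist_le_of_near hw.symm)
    unfold MarkReader.marks
    rw [hx w (gridDist_le_of_near hw.symm)]

variable (G) in
/-- The algorithm that computes the answer at every vertex. -/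
noncomputable def algorithm (hd : 1 ≤ d) (hP : P.IsRapid d) (f : MarkReader d P) :
    UniformAlgorithm d Sin Sout := (G.stages hd hP f).algorithm

/-- If some level `i ≤ k` is good, the origin lies in a piece of level `i` and stage `k` answers.
The constant turns the sup-radius `20 * r k` into an `ℓ¹`-radius, at the cost of a factor `d`. -/
theorem isFast_algorithm (hd : 1 ≤ d) (hP : P.IsRapid d) (f : MarkReader d P) :
    (G.algorithm hd hP f).IsFast (d * (40 * (P.q + 1))) (badConst d) := by
  refine ⟨f.badUpTo, fun k => ⟨f.measurableSet_badUpTo k, f.measure_badUpTo_le hP k,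
    fun σ x hx => ?_⟩⟩
  simp only [MarkReader.badUpTo, Set.mem_ofPred_eq, not_forall] at hx
  obtain ⟨i, hi, hxi⟩ := hx
  have hdeep : P.Deep (f.marks x) i 0 := (f.inner_of_notMem_bad hP hxi).mono (by omega)
  obtain ⟨D, hD, hD0⟩ := hdeep.exists_mem_level
  have h0 : (0 : Grid d) ∈ D := Finset.mem_coe.1 (hD0 ▸ Scales.self_mem_component)
  have h1 : (G.stages hd hP f).attempt k σ x ≠ none := stage_ne_none (⟨i, hi, hD⟩) h0
  refine (Stages.radius_le h1).trans ?_
  have h2 : (G.stages hd hP f).ρ k = d * (40 * (P.q + 1)) * 16 ^ (k ^ 2) := by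
    change d * (20 * P.r k) = _
    rw [hP.r_eq]; ring
  rw [h2]

theorem marks_add_left (f : MarkReader d P) (x : Grid d → unitInterval) (v : Grid d) :
    f.marks (fun u => x (v + u)) = fun k j u => f.marks x k j (u + v) := by
  funext k j u
  simp [MarkReader.marks, add_comm]

/-- Running at `v` means running at the origin on translated labels. The collection `𝒟` consists of
the translated pieces up to the successful level: a truncation of the toast that agrees with it
inside the least piece, which is all an answer depends on. -/
theorem exists_output_eq (hd : 1 ≤ d) (hP : P.IsRapid d) (f : MarkReader d P) (σ : Grid d → Sin)
    {x : Grid d → unitInterval} (hx : IsToast P.q (P.toast (f.marks x))) (v : Grid d) :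
    ∃ (𝒟 : Set (Finset (Grid d))) (D : Finset (Grid d)) (o : Sout),
      (∀ E ∈ 𝒟, IsPiece E) ∧ D ∈ 𝒟 ∧ (∀ E ⊆ D, E ∈ 𝒟 ↔ shiftSet v E ∈ P.toast (f.marks x)) ∧
      IsLeast {E | E ∈ P.toast (f.marks x) ∧ v ∈ E} (shiftSet v D) ∧
      G.ans 𝒟 (fun u => σ (u + v)) D = some o ∧ (G.algorithm hd hP f).output σ x v = some o := by
  let χ := f.marks x
  let χ' : Marks d := fun k j u => χ k j (u + v)
  have hχ' : f.marks (fun u => x (v + u)) = χ' := marks_add_left f x v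
  have hshift : ∀ k E, E ∈ P.levelsUpTo χ' k ↔ shiftSet v E ∈ P.levelsUpTo χ k := fun k E =>
    Scales.mem_levelsUpTo_shift v
  have hmem0 : ∀ E : Finset (Grid d), 0 ∈ E ↔ v ∈ shiftSet v E := fun E => by
    rw [mem_shiftSet', sub_self]
  have hex : ∃ k, (G.stages hd hP f).attempt k (fun u => σ (v + u)) (fun u => x (v + u)) ≠ none := by
    obtain ⟨D, ⟨k, hD⟩, hvD, -⟩ := hx.cover v v
    refine ⟨k, ?_⟩
    change G.stage P (f.marks fun u => x (v + u)) k _ ≠ none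
    rw [hχ']
    refine stage_ne_none (D := shiftSet (-v) D) ((hshift k _).2 ?_) ((hmem0 _).2 ?_)
    · rw [shiftSet_shiftSet_neg]; exact ⟨k, le_rfl, hD⟩
    · rwa [shiftSet_shiftSet_neg]
  obtain ⟨k, o, ho, hout⟩ := Stages.exists_output_eq hex
  change G.stage P (f.marks fun u => x (v + u)) k _ = some o at ho
  rw [hχ'] at ho
  have hleast : ∃ D, IsLeast {E | E ∈ P.levelsUpTo χ' k ∧ 0 ∈ E} D := by
    by_contra hc
    rw [stage, dif_neg hc] at ho
    exact absurd ho (by simp)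
  obtain ⟨D, hD⟩ := hleast
  rw [stage_eq hD] at ho
  have hD' : IsLeast {E | E ∈ P.levelsUpTo χ k ∧ v ∈ E} (shiftSet v D) := by
    refine ⟨⟨(hshift k D).1 hD.1.1, (hmem0 D).1 hD.1.2⟩, ?_⟩
    rintro E ⟨hE, hvE⟩
    rw [← shiftSet_shiftSet_neg v E] at hE hvE ⊢
    exact Finset.map_subset_map.2 (hD.2 ⟨(hshift k _).2 hE, (hmem0 _).2 hvE⟩)
  refine ⟨P.levelsUpTo χ' k, D, o, fun E hE => Scales.isPiece_of_mem_levelsUpTo hE, hD.1.1,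
    fun E hE => ?_, Scales.isLeast_toast hD', ?_, hout⟩
  · rw [hshift]
    constructor
    · rintro ⟨l, -, h⟩
      exact ⟨l, h⟩
    · exact fun h => Scales.mem_levelsUpTo_of_subset hD'.1.1 h (Finset.map_subset_map.2 hE)
  · simpa only [add_comm] using ho

end PieceAnswer

/-- The answer that describes the least piece. -/
def describeAnswer (d : ℕ) : PieceAnswer d Unit (Finset (Grid d)) where
  ans _ _ D := some D
  ans_ne_none := by simp
  ans_congr := by simp

open Classical in
/-- The answer that tells whether the origin is on the boundary of the least piece. -/
noncomputable def boundaryAnswer (d : ℕ) : PieceAnswer d Unit Bool where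
  ans _ _ D := some (decide (0 ∈ boundary D))
  ans_ne_none := by simp
  ans_congr := by simp

/-- The answer that is given by a toast algorithm. -/
noncomputable def ToastAlgorithm.answer {Sin Sout : Type*} (A : ToastAlgorithm d Sin Sout)
    (hA : A.IsSpontaneous) : PieceAnswer d Sin Sout where
  ans 𝒟 σ D := A.colorPiece 𝒟 σ D 0
  ans_ne_none _ _ D h𝒟 hD h0 := hA.colorPiece_ne_none h𝒟 (h𝒟 D hD) h0
  ans_congr _ _ _ _ D h𝒟 h𝒟' hD h hσ :=
    ToastAlgorithm.colorPiece_congr h𝒟' (h𝒟 D hD) (fun E hE => (h E hE).symm) hσ 0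

theorem mem_boundary_shiftSet {v : Grid d} {D : Finset (Grid d)} :
    v ∈ boundary (shiftSet v D) ↔ 0 ∈ boundary D := by
  constructor
  · rintro ⟨h, w, hw, hadj⟩
    refine ⟨by simpa [mem_shiftSet'] using h, w - v, by simpa [mem_shiftSet'] using hw, ?_⟩
    rw [← gridGraph_adj_add_right v]
    simpa using hadj
  · rintro ⟨h, w, hw, hadj⟩
    refine ⟨by simpa [mem_shiftSet'] using h, w + v, by simpa [mem_shiftSet] using hw, ?_⟩
    rw [← gridGraph_adj_add_right v] at hadj
    simpa using hadj

/-- A vertex on the boundary of some piece is on the boundary of the least piece that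
contains it. -/
theorem mem_boundary_iff_of_isLeast {𝒟 : Set (Finset (Grid d))} {v : Grid d} {D : Finset (Grid d)} (hD : IsLeast {E | E ∈ 𝒟 ∧ v ∈ E} D) :
    v ∈ boundary D ↔ ∃ E ∈ 𝒟, v ∈ boundary E := by
  refine ⟨fun hv => ⟨D, hD.1.1, hv⟩, ?_⟩
  rintro ⟨E, hE, hv⟩
  have hDE : D ⊆ E := hD.2 ⟨hE, hv.1⟩
  obtain ⟨-, w, hw, hadj⟩ := hv
  exact ⟨hD.1.2, w, fun hwD => hw (hDE hwD), hadj⟩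

end GridLocal

/-! ### Assembly: producing the toast and solving the LCL -/

theorem producesToast_algorithms {d : ℕ} (hd : 1 ≤ d) {P : Scales} (hP : P.IsRapid d)
    (f : MarkReader d P) : ProducesToast P.q ((boundaryAnswer d).algorithm hd hP f)
      ((describeAnswer d).algorithm hd hP f) := by
  filter_upwards [f.ae_isToast hP] with x hx
  refine ⟨P.toast (f.marks x), hx, fun v => ?_, fun v => ?_⟩
  · obtain ⟨𝒟, D, o, -, -, -, hD, ho, hout⟩ :=
      PieceAnswer.exists_output_eq (G := boundaryAnswer d) hd hP f (fun _ => ()) hx v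
    refine ⟨o, hout, ?_⟩
    rw [← mem_boundary_iff_of_isLeast hD, mem_boundary_shiftSet]
    simp only [boundaryAnswer, Option.some.injEq] at ho
    rw [← ho]
    simp
  · obtain ⟨𝒟, D, o, -, -, -, hD, ho, hout⟩ :=
      PieceAnswer.exists_output_eq (G := describeAnswer d) hd hP f (fun _ => ()) hx v
    simp only [describeAnswer, Option.some.injEq] at ho
    exact ⟨o, hout, ho ▸ hD⟩

/-- The output at `v` is the colour that the toast algorithm gives `v` in its least piece, computed
in a translated, truncated toast. Equivariance and locality of `colorPiece` identify it with the
value of `colorGrid` along the full toast. -/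
theorem solves_algorithm {d : ℕ} (hd : 1 ≤ d) {P : Scales} (hP : P.IsRapid d) (f : MarkReader d P)
    {Sin Sout : Type*} {L : LCL d Sin Sout} {A : ToastAlgorithm d Sin Sout} (hA : A.IsSpontaneous)
    (hL : ∀ (σ : Grid d → Sin) (𝒟 : Set (Finset (Grid d))), IsToast P.q 𝒟 →
      ∃ c : Grid d → Sout, (∀ v, A.colorGrid 𝒟 σ v = some (c v)) ∧ L.IsColoring σ c) :
    ((A.answer hA).algorithm hd hP f).Solves L := by
  intro σ
  filter_upwards [f.ae_isToast hP] with x hx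
  obtain ⟨c, hc, hcol⟩ := hL σ _ hx
  refine ⟨c, fun v => ?_, hcol⟩
  obtain ⟨𝒟, D, o, h𝒟, hD𝒟, hsub, hD, ho, hout⟩ :=
    PieceAnswer.exists_output_eq (G := A.answer hA) hd hP f σ hx v
  rw [hout, ← hc v, hA.colorGrid_eq_of_isLeast hx.isPiece hD, ← ho]
  have := ToastAlgorithm.colorPiece_shift (A := A) (𝒟 := P.toast (f.marks x)) (σ := σ) v h𝒟
    (h𝒟 D hD𝒟) hsub (fun _ _ => rfl) 0
  rw [zero_add] at this
  exact this.symm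

theorem theorem4p1 (d : ℕ) (hd : 1 ≤ d) :
    (∀ q : ℕ, ∃ t ∈ toastRate,
      ∃ (B : UniformAlgorithm d Unit Bool) (P : UniformAlgorithm d Unit (Finset (Grid d))),
        ProducesToast q B P ∧ B.HasComplexity t ∧ P.HasComplexity t) ∧
    (∀ (Sin Sout : Type*) [Finite Sin] [Finite Sout] (L : LCL d Sin Sout), L.InToast →
      L.InULocal toastRate ∧ L.InULocal nearLinearRate ∧ 1 ≤ L.momentExponent) ∧
    (∀ (Sin Sout : Type*) [Finite Sin] [Finite Sout] (L : LCL d Sin Sout),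
      L.InULocal toastRate → L.InULocal nearLinearRate) := by
  have hc : ∀ q : ℕ, 0 < d * (40 * (q + 1)) := fun q => by positivity
  have hrate : ∀ q : ℕ, ∃ t ∈ toastRate, ∀ ε ∈ Set.Ioo (0 : ℝ) 1, ∃ k : ℕ,
      badConst d ^ k / 16 ^ (k ^ 2) < ε ∧ (d * (40 * (q + 1)) : ℕ) * 16 ^ (k ^ 2) ≤ t ε :=
    fun q => exists_toastRate (by exact_mod_cast hc q) (one_le_badConst d)
  refine ⟨fun q => ?_, fun Sin Sout _ _ L hL => ?_,
    fun Sin Sout _ _ L hL => hL.mono toastRate_subset_nearLinearRate⟩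
  · obtain ⟨P, rfl, hP⟩ := Scales.exists_isRapid d q
    obtain ⟨f⟩ := nonempty_markReader d P
    obtain ⟨t, ht, hcomp⟩ := hrate P.q
    exact ⟨t, ht, _, _, producesToast_algorithms hd hP f,
      (PieceAnswer.isFast_algorithm hd hP f).hasComplexity hcomp,
      (PieceAnswer.isFast_algorithm hd hP f).hasComplexity hcomp⟩
  · obtain ⟨q, A, hA, hsol⟩ := hL
    obtain ⟨P, rfl, hP⟩ := Scales.exists_isRapid d q
    obtain ⟨f⟩ := nonempty_markReader d P
    obtain ⟨t, ht, hcomp⟩ := hrate P.q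
    have hsolves := solves_algorithm hd hP f hA hsol
    have hfast := PieceAnswer.isFast_algorithm (G := A.answer hA) hd hP f
    have hloc : L.InULocal toastRate := ⟨t, ht, _, hsolves, hfast.hasComplexity hcomp⟩
    exact ⟨hloc, hloc.mono toastRate_subset_nearLinearRate,
      LCL.one_le_momentExponent hsolves hfast (hc _) (by linarith [one_le_badConst d])⟩
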